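/- Let $w_1,\dots,w_k$ be contracting similarities of $\mathbb R^N$, $\|w_i(x)-w_i(y)\|=\lambda_i\|x-y\|$ with $0<\lambda_i<1$, and let $K$ be the nonempty compact set with $K=\bigcup_i w_i(K)$. Let $p_i$ be the fixed point of $w_i$. Call $p_i$ essential if $w_j(p_i)=w_{j'}(p_{i'})$ for some $j,j'$ and some $i'\ne i$. Let $V_0$ be the set of essential fixed points and $E_0=\{(p,q):p,q\in V_0,\ p\neq q\}$. For a word $\sigma$ of length $|\sigma|=n$ put $w_\sigma=w_{\sigma(1)}\circ\dots\circ w_{\sigma(n)}$, and call $w_\sigma(V_0)$ a combinatorial $n$-cell. Let $V_1=\bigcup_i w_i(V_0)$ and $E_1=\{(w_i(p),w_i(q)):(p,q)\in E_0,\ 1\le i\le k\}$. Assume that $K$ is a nested fractal, that is, $V_0$ has at least two points and: 1. $\lambda_i=\lambda$ for all $i$. 2. There is a nonempty bounded open set $U$ with $\bigcup_i w_i(U)\subset U$ and the sets $w_i(U)$ pairwise disjoint. 3. The graph $(V_1,E_1)$ is connected. 4. For distinct words $\sigma,\sigma'$ of the same length, $w_\sigma(V_0)\ne w_{\sigma'}(V_0)$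 and $w_\sigma(K)\cap w_{\sigma'}(K)=w_\sigma(V_0)\cap w_{\sigma'}(V_0)$. 5. For distinct $p,q\in V_0$ and every $n\ge0$, the reflection in $\{z:\|z-p\|=\|z-q\|\}$ maps combinatorial $n$-cells to combinatorial $n$-cells, and maps to itself each one with points strictly on both sides of this hyperplane. Let $\ell(e)=\|p-q\|$ for $e=(p,q)\in E_0$, and write $e^+=p$. On $\mathcal H=\bigoplus_\sigma \ell^2(E_0)$ (sum over all finite words) let $f\in C(K)$ act by multiplying the coordinate $(\sigma,e)$ by $f(w_\sigma(e^+))$. Let $D=\bigoplus_\sigma\lambda^{-|\sigma|}D_o$ be the self-adjoint operator for which $D_o$ maps the basis vector of $e=(p,q)$ to $\ell(e)^{-1}$ times that of $(q,p)$. Put $d=\log k/\log(1/\lambda)$. Then: (a) The metric dimension of the triple, i.e. the abscissa of convergence of $\mathcal Z(s)=\mathrm{tr}(|D|^{-s})$, is $d$. For $\operatorname{Re}s>d$ the operator $|D|^{-s}$ is trace class, and $\mathcal Z$ has the meromorphic extension to $\mathbb C$ $$\mathcal Z(s)=\frac{\sum_{e\in E_0}\ell(e)^s}{1-k\lambda^s}.$$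 (b) The dimension spectrum, i.e. the set of poles of this extension, is $$\Big\{z=d\Big(1+\frac{2\pi i n}{\log k}\Big): n\in\mathbb Z,\ \sum_{e\in E_0}\ell(e)^z\neq0\Big\}.$$ In particular it is the whole set $\{d(1+2\pi i n/\log k):n\in\mathbb Z\}$ if the numerator vanishes at none of these points, for example if all edges of $E_0$ have the same length. The pole at $d$ is simple. (c) $|D|^{-d}$ is compact and $S_n(|D|^{-d})/\log n$ is bounded, where $S_n(T)$ is the sum of the $n$ largest eigenvalues of $|T|$, counted with multiplicity. The $d$-dimensional Hausdorff measure of $K$ is positive and finite. Let $H_d$ be this measure on $K$, normalized so that $H_d(K)=1$. Let $\omega$ be any positive linear functional on bounded real sequences that extends the limit. Set $\mathrm{tr}_\omega(T)=\omega\big((S_n(T)/\log n)_n\big)$ for $T\ge0$, and extend it to general $T$ through the positive and negative parts of the real and imaginary parts of $T$. Then for all $f\in C(K)$ $$\oint f=\mathrm{tr}_\omega(f|D|^{-d})=\frac1{\log k}\sum_{e\in E_0}\ell(e)^d\int_K f\,dH_d .$$ Consequently the only finite Borel measure on $K$ that represents the functional $f\mapsto\oint f$ is $\frac1{\log k}\sum_{e\in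 E_0}\ell(e)^d\,H_d$. -/

import Mathlib

open scoped ENNReal MeasureTheory BoundedContinuousFunction ComplexStarModule

noncomputable section

/-! ### Operators on a Hilbert space -/

section Operators

universe u

variable {H : Type u} [NormedAddCommGroup H] [InnerProductSpace ℂ H] [CompleteSpace H]

/-- `B` is the (everywhere defined, bounded) inverse of the unbounded operator `D`:
the graph of `D` is `{(x, y) | x = B y}`. Such a `B` is unique. -/
def IsBoundedInverse (D : H →ₗ.[ℂ] H) (B : H →L[ℂ] H) : Prop :=
  ∀ p : H × H, p ∈ D.graph ↔ B p.2 = p.1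

open Classical in
/-- The bounded inverse of an invertible unbounded operator (and `0` if there is none). -/
def boundedInverse (D : H →ₗ.[ℂ] H) : H →L[ℂ] H :=
  if h : ∃ B, IsBoundedInverse D B then h.choose else 0

/-- `|D|^{-s}` for an invertible self-adjoint operator `D` and `Re s > 0`, by the continuous
functional calculus: the function `x ↦ x ^ s` applied to `|D|⁻¹ = |D⁻¹|`. -/
def absNegPow (D : H →ₗ.[ℂ] H) (s : ℂ) : H →L[ℂ] H :=
  cfc (fun z : ℂ => z ^ s) (CFC.abs (boundedInverse D))

/-- `T` is trace class: the trace of `|T|` is finite (in every orthonormal basis). -/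
def IsTraceClass (T : H →L[ℂ] H) : Prop :=
  ∀ (ι : Type u) (b : HilbertBasis ι ℂ H),
    Summable fun i => (inner ℂ (b i) (CFC.abs T (b i)) : ℂ)

/-- The trace of a trace class operator, computed in some orthonormal basis (for a trace class
operator the value does not depend on the basis). -/
def opTrace (T : H →L[ℂ] H) : ℂ :=
  ∑' i, inner ℂ ((exists_hilbertBasis ℂ H).choose_spec.choose i)
    (T ((exists_hilbertBasis ℂ H).choose_spec.choose i))

/-- The zeta function `s ↦ tr (|D|^{-s})`. -/
def zetaFun (D : H →ₗ.[ℂ] H) (s : ℂ) : ℂ := opTrace (absNegPow D s)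

/-- The metric dimension: the abscissa of convergence of the zeta function. -/
def metricDim (D : H →ₗ.[ℂ] H) : ℝ :=
  sInf {s : ℝ | 0 < s ∧ IsTraceClass (absNegPow D (s : ℂ))}

/-- `g` is a meromorphic extension to the whole plane of the zeta function, which is defined (by an
operator of trace class) on the half plane to the right of the abscissa of convergence. -/
def IsMeromorphicExtension (D : H →ₗ.[ℂ] H) (g : ℂ → ℂ) : Prop :=
  Meromorphic g ∧
    ∀ s : ℂ, metricDim D < s.re → IsTraceClass (absNegPow D s) ∧ zetaFun D s = g s

/-- The dimension spectrum: the poles of the meromorphic extension of the zeta function. -/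
def dimensionSpectrum (D : H →ₗ.[ℂ] H) : Set ℂ :=
  {z | ∃ g : ℂ → ℂ, IsMeromorphicExtension D g ∧ meromorphicOrderAt g z < 0}

/-- The `j`-th largest eigenvalue (`j = 0, 1, 2, …`), counted with multiplicity, of `|T|` for a
compact operator `T`: the least `t ≥ 0` such that at most `j` eigenvalues, counted with
multiplicity, exceed `t`. -/
def singVal (T : H →L[ℂ] H) (j : ℕ) : ℝ :=
  sInf {t : ℝ | 0 ≤ t ∧
    Module.rank ℂ
      (⨆ (r : ℝ) (_ : t < r), Module.End.eigenspace (CFC.abs T).toLinearMap (r : ℂ) :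
        Submodule ℂ H) ≤ j}

/-- `S_n(T)`: the sum of the `n` largest eigenvalues of `|T|`. -/
def singSum (T : H →L[ℂ] H) (n : ℕ) : ℝ := ∑ j ∈ Finset.range n, singVal T j

/-- The sequence `S_n(T) / log n` (with value `0` at `n = 0` and `n = 1`). -/
def logMean (T : H →L[ℂ] H) (n : ℕ) : ℝ := singSum T n / Real.log n

/-- The Macaev ideal `𝓛^{1,∞}`: compact operators for which `S_n(T) / log n` is bounded. -/
def InMacaevIdeal (T : H →L[ℂ] H) : Prop :=
  IsCompactOperator T ∧ ∃ C : ℝ, ∀ n, ‖logMean T n‖ ≤ C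

/-- A generalized limit `ω`: a positive linear functional on bounded real sequences that extends
the ordinary limit. Invariance under dilations may hold in addition. -/
structure GeneralizedLimit where
  toLin : (ℕ →ᵇ ℝ) →ₗ[ℝ] ℝ
  nonneg : ∀ a : ℕ →ᵇ ℝ, 0 ≤ a → 0 ≤ toLin a
  eq_limit : ∀ (a : ℕ →ᵇ ℝ) (L : ℝ), Filter.Tendsto a Filter.atTop (nhds L) → toLin a = L

open Classical in
/-- `lim_ω S_n(T) / log n`, for a positive operator `T` in the Macaev ideal. -/
def dixmierPos (ω : GeneralizedLimit) (T : H →L[ℂ] H) : ℝ :=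
  if h : ∃ C : ℝ, ∀ n, ‖logMean T n‖ ≤ C then
    ω.toLin (BoundedContinuousFunction.ofNormedAddCommGroupDiscrete (logMean T) h.choose
      h.choose_spec)
  else 0

/-- The Dixmier trace of an operator in the Macaev ideal, extended from positive operators through
`T = (Re T)⁺ - (Re T)⁻ + i ((Im T)⁺ - (Im T)⁻)`. -/
def dixmierTrace (ω : GeneralizedLimit) (T : H →L[ℂ] H) : ℂ :=
  ((dixmierPos ω ((ℜ T : H →L[ℂ] H)⁺) - dixmierPos ω ((ℜ T : H →L[ℂ] H)⁻) : ℝ) : ℂ) +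
    Complex.I *
      ((dixmierPos ω ((ℑ T : H →L[ℂ] H)⁺) - dixmierPos ω ((ℑ T : H →L[ℂ] H)⁻) : ℝ) : ℂ)

/-- The noncommutative integral `∮ a = tr_ω (a |D|^{-d})`, `d` the metric dimension. -/
def ncIntegral (D : H →ₗ.[ℂ] H) (ω : GeneralizedLimit) (a : H →L[ℂ] H) : ℂ :=
  dixmierTrace ω (a * absNegPow D (metricDim D : ℂ))

end Operators

/-! ### Self-similar and nested fractals -/

/-- The self-similar fractal `K` of `k` contracting similarities `w i` of `ℝ^N`. -/
structure SelfSimilarFractal (N k : ℕ) where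
  w : Fin k → EuclideanSpace ℝ (Fin N) → EuclideanSpace ℝ (Fin N)
  ratio : Fin k → ℝ
  ratio_pos : ∀ i, 0 < ratio i
  ratio_lt_one : ∀ i, ratio i < 1
  dist_w : ∀ i x y, dist (w i x) (w i y) = ratio i * dist x y
  K : Set (EuclideanSpace ℝ (Fin N))
  nonempty_K : K.Nonempty
  isCompact_K : IsCompact K
  K_eq : K = ⋃ i, w i '' K

namespace SelfSimilarFractal

variable {N k : ℕ} (F : SelfSimilarFractal N k)

/-- `w_σ = w_{σ(1)} ∘ ⋯ ∘ w_{σ(n)}`; words of length `n` are lists of length `n`. -/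
def wWord : List (Fin k) → EuclideanSpace ℝ (Fin N) → EuclideanSpace ℝ (Fin N)
  | [] => id
  | i :: σ => F.w i ∘ wWord σ

/-- `λ_σ = λ_{σ(1)} ⋯ λ_{σ(n)}`. -/
def ratioWord (σ : List (Fin k)) : ℝ := (σ.map F.ratio).prod

/-- The set `V₀` of essential fixed points. -/
def V₀ : Set (EuclideanSpace ℝ (Fin N)) :=
  {p | ∃ i, F.w i p = p ∧ ∃ i' j j' p', i' ≠ i ∧ F.w i' p' = p' ∧ F.w j p = F.w j' p'}

/-- The combinatorial cell `w_σ(V₀)`. -/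
def cell (σ : List (Fin k)) : Set (EuclideanSpace ℝ (Fin N)) := F.wWord σ '' F.V₀

/-- The vertex set `V_n`. -/
def V (n : ℕ) : Set (EuclideanSpace ℝ (Fin N)) :=
  {x | ∃ σ : List (Fin k), σ.length = n ∧ x ∈ F.cell σ}

/-- `(x, y) ∈ E_n`. -/
def IsEdge (n : ℕ) (x y : EuclideanSpace ℝ (Fin N)) : Prop :=
  ∃ σ : List (Fin k), σ.length = n ∧
    ∃ p ∈ F.V₀, ∃ q ∈ F.V₀, p ≠ q ∧ F.wWord σ p = x ∧ F.wWord σ q = y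

/-- The reflection in the hyperplane of points equidistant from `p` and `q`. -/
def mirror (p q : EuclideanSpace ℝ (Fin N)) :
    EuclideanSpace ℝ (Fin N) → EuclideanSpace ℝ (Fin N) :=
  haveI : Nonempty (AffineSubspace.perpBisector p q) :=
    AffineSubspace.perpBisector_nonempty.to_subtype
  EuclideanGeometry.reflection (AffineSubspace.perpBisector p q)

/-- `(K, {w_i})` is a nested fractal with scaling parameter `lam`. -/
structure IsNested (lam : ℝ) : Prop where
  nontrivial_V₀ : F.V₀.Nontrivial
  ratio_eq : ∀ i, F.ratio i = lam
  open_set_condition : ∃ U : Set (EuclideanSpace ℝ (Fin N)),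
    IsOpen U ∧ Bornology.IsBounded U ∧ U.Nonempty ∧ (∀ i, F.w i '' U ⊆ U) ∧
      ∀ i j, i ≠ j → Disjoint (F.w i '' U) (F.w j '' U)
  connected : ∀ x ∈ F.V 1, ∀ y ∈ F.V 1, Relation.ReflTransGen (F.IsEdge 1) x y
  nesting : ∀ σ τ : List (Fin k), σ.length = τ.length → σ ≠ τ →
    F.cell σ ≠ F.cell τ ∧
      (F.wWord σ '' F.K) ∩ (F.wWord τ '' F.K) = F.cell σ ∩ F.cell τ
  symmetry : ∀ p ∈ F.V₀, ∀ q ∈ F.V₀, p ≠ q → ∀ σ : List (Fin k),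
    (∃ τ : List (Fin k), τ.length = σ.length ∧ mirror p q '' F.cell σ = F.cell τ) ∧
      ((∃ x ∈ F.cell σ, ∃ y ∈ F.cell σ, dist x p < dist x q ∧ dist y q < dist y p) →
        mirror p q '' F.cell σ = F.cell σ)

/-- The oriented edges `e = (e⁺, e⁻) ∈ E₀`. -/
def Edge : Type :=
  {e : EuclideanSpace ℝ (Fin N) × EuclideanSpace ℝ (Fin N) //
    e.1 ∈ F.V₀ ∧ e.2 ∈ F.V₀ ∧ e.1 ≠ e.2}

variable {F}

/-- The edge with the opposite orientation. -/
def Edge.rev (e : F.Edge) : F.Edge :=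
  ⟨(e.1.2, e.1.1), e.2.2.1, e.2.1, e.2.2.2.symm⟩

/-- The (Euclidean) length of an edge. -/
def Edge.len (e : F.Edge) : ℝ := dist e.1.1 e.1.2

variable (F)

theorem fixedPoint_unique {i : Fin k} {p q : EuclideanSpace ℝ (Fin N)}
    (hp : F.w i p = p) (hq : F.w i q = q) : p = q := by
  have h := F.dist_w i p q
  rw [hp, hq] at h
  have h1 := F.ratio_lt_one i
  have h2 : 0 ≤ dist p q := dist_nonneg
  exact dist_eq_zero.1 (by nlinarith)

theorem finite_V₀ : F.V₀.Finite := by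
  have h : F.V₀ ⊆ ⋃ i, {p | F.w i p = p} := by
    rintro p ⟨i, hi, -⟩
    exact Set.mem_iUnion.2 ⟨i, hi⟩
  refine (Set.finite_iUnion fun i => ?_).subset h
  exact Set.Subsingleton.finite fun p hp q hq => F.fixedPoint_unique hp hq

instance : Finite F.Edge := by
  have : Finite F.V₀ := F.finite_V₀
  refine Finite.of_injective (β := F.V₀ × F.V₀)
    (fun e => (⟨e.1.1, e.2.1⟩, ⟨e.1.2, e.2.2.1⟩)) ?_
  intro a b h
  simp only [Prod.mk.injEq, Subtype.mk.injEq] at h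
  exact Subtype.ext (Prod.ext h.1 h.2)

instance : Fintype F.Edge := Fintype.ofFinite _

theorem w_mem {i : Fin k} {x : EuclideanSpace ℝ (Fin N)} (hx : x ∈ F.K) : F.w i x ∈ F.K := by
  rw [F.K_eq]
  exact Set.mem_iUnion.2 ⟨i, x, hx, rfl⟩

theorem wWord_mem (σ : List (Fin k)) {x : EuclideanSpace ℝ (Fin N)} (hx : x ∈ F.K) :
    F.wWord σ x ∈ F.K := by
  induction σ with
  | nil => exact hx
  | cons i σ ih => exact F.w_mem ih

theorem V₀_subset : F.V₀ ⊆ F.K := by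
  rintro p ⟨i, hi, -⟩
  obtain ⟨x, hx⟩ := F.nonempty_K
  have hd : ∀ n : ℕ, dist ((F.w i)^[n] x) p = F.ratio i ^ n * dist x p := by
    intro n
    induction n with
    | zero => simp
    | succ n ih =>
      rw [Function.iterate_succ_apply']
      nth_rewrite 1 [← hi]
      rw [F.dist_w, ih, pow_succ]
      ring
  have hm : ∀ n : ℕ, (F.w i)^[n] x ∈ F.K := by
    intro n
    induction n with
    | zero => exact hx
    | succ n ih =>
      rw [Function.iterate_succ_apply']
      exact F.w_mem ih
  refine F.isCompact_K.isClosed.mem_of_tendsto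
    (b := Filter.atTop) (f := fun n : ℕ => (F.w i)^[n] x) ?_ (Filter.Eventually.of_forall hm)
  rw [tendsto_iff_dist_tendsto_zero]
  simp only [hd]
  simpa using (tendsto_pow_atTop_nhds_zero_of_lt_one (F.ratio_pos i).le
    (F.ratio_lt_one i)).mul_const (dist x p)

/-! ### The discrete spectral triple -/

/-- The oriented edges of all levels: `(σ, e)` labels the copy of `e ∈ E₀` in the `σ`-summand. -/
abbrev Index : Type := List (Fin k) × F.Edge

/-- The Hilbert space `⊕_σ ⊕_{e ∈ E₀} ℂ`. -/
abbrev Hilb : Type := lp (fun _ : F.Index => ℂ) 2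

/-- The length `λ_σ ℓ(e)` of the edge `(σ, e)`. -/
def indexLen (x : F.Index) : ℝ := F.ratioWord x.1 * x.2.len

/-- The point `w_σ(e⁺)` of `K`. -/
def indexPoint (x : F.Index) : F.K :=
  ⟨F.wWord x.1 x.2.1.1, F.wWord_mem x.1 (F.V₀_subset x.2.2.1)⟩

/-- The Dirac operator `D = ⊕_σ λ_σ⁻¹ D_o`, where `D_o = F_o |D_o|` sends an oriented edge `e` to
`ℓ(e)⁻¹` times the edge with the opposite orientation, with its maximal domain. -/
def dirac : F.Hilb →ₗ.[ℂ] F.Hilb where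
  domain :=
    { carrier := {ξ | Memℓp (fun x : F.Index =>
        (((F.indexLen x)⁻¹ : ℝ) : ℂ) * ξ (x.1, x.2.rev)) 2}
      add_mem' := by
        intro a b ha hb
        have h := Memℓp.add ha hb
        refine (congrArg (fun f => Memℓp f 2) ?_).mp h
        funext x
        simp [mul_add]
      zero_mem' := by
        refine (congrArg (fun f => Memℓp f 2) ?_).mp (zero_memℓp (E := fun _ : F.Index => ℂ))
        funext x
        simp
      smul_mem' := by
        intro c a ha
        have h := Memℓp.const_smul ha c
        refine (congrArg (fun f => Memℓp f 2) ?_).mp h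
        funext x
        simp [mul_left_comm] }
  toFun :=
    { toFun := fun ξ => ⟨fun x : F.Index =>
        (((F.indexLen x)⁻¹ : ℝ) : ℂ) * (ξ : F.Hilb) (x.1, x.2.rev), ξ.2⟩
      map_add' := by
        intro a b
        ext x
        exact mul_add _ _ _
      map_smul' := by
        intro c a
        ext x
        simp [mul_left_comm] }

theorem memℓp_mul (f : C(F.K, ℂ)) (ξ : F.Hilb) :
    Memℓp (fun x : F.Index => f (F.indexPoint x) * ξ x) 2 := by
  have : CompactSpace F.K := isCompact_iff_compactSpace.1 F.isCompact_K
  refine Memℓp.mono' (Memℓp.const_smul (lp.memℓp ξ) (‖f‖ : ℂ)) fun x => ?_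
  simp only [norm_mul, Pi.smul_apply, smul_eq_mul, Complex.norm_real, norm_norm]
  exact mul_le_mul_of_nonneg_right (f.norm_coe_le_norm _) (norm_nonneg _)

/-- The representation of `C(K)`: `π(f)` multiplies the coordinate `(σ, e)` by `f(w_σ(e⁺))`. -/
def rep (f : C(F.K, ℂ)) : F.Hilb →L[ℂ] F.Hilb :=
  haveI : CompactSpace F.K := isCompact_iff_compactSpace.1 F.isCompact_K
  LinearMap.mkContinuous
    { toFun := fun ξ => ⟨fun x : F.Index => f (F.indexPoint x) * ξ x, F.memℓp_mul f ξ⟩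
      map_add' := by
        intro a b
        ext x
        exact mul_add _ _ _
      map_smul' := by
        intro c a
        ext x
        simp [mul_left_comm] } ‖f‖ (by
      intro ξ
      have h := lp.norm_mono (p := 2) two_ne_zero
        (x := (⟨fun x : F.Index => f (F.indexPoint x) * ξ x, F.memℓp_mul f ξ⟩ : F.Hilb))
        (y := (‖f‖ : ℂ) • ξ) (fun x => by
          simp only [norm_mul, lp.coeFn_smul, Pi.smul_apply, smul_eq_mul, Complex.norm_real,
            norm_norm]
          exact mul_le_mul_of_nonneg_right (f.norm_coe_le_norm _) (norm_nonneg _))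
      refine h.trans ?_
      rw [norm_smul]
      simp)

/-- The numerator `∑_{e ∈ E₀} ℓ(e)^s`. -/
def edgeSum (s : ℂ) : ℂ := ∑ e : F.Edge, (e.len : ℂ) ^ s

/-- The Hausdorff measure `H_d` on `K`, normalized to total mass `1`. -/
def normalizedHausdorff (d : ℝ) : MeasureTheory.Measure F.K :=
  (MeasureTheory.Measure.hausdorffMeasure d F.K)⁻¹ •
    MeasureTheory.Measure.comap Subtype.val
      (MeasureTheory.Measure.hausdorffMeasure d :
        MeasureTheory.Measure (EuclideanSpace ℝ (Fin N)))

end SelfSimilarFractal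

end

/-!
The operator `|D|⁻ˢ` is diagonal in the basis of the cell edges, with entry `ℓ(w_σ e)ˢ` at `(σ, e)`.
All contraction ratios being equal to `λ`, level `n` contributes `kⁿ λⁿˢ ∑ ℓ(e)ˢ` to its trace, and
the zeta function is a geometric series.

By the Moran equation `k λᵈ = 1` each level contributes the same amount to the trace of
`f |D|⁻ᵈ`, namely `∑ ℓ(e)ᵈ` times an average of `f` over the `kⁿ` cells of level `n`. These averages
converge to `∫ f dH_d`, since the open set condition makes cells of the same level share no
`H_d`-mass. As the levels below `n` make up about `kⁿ` eigenvalues, a Cesàro mean over the levels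
becomes the logarithmic mean defining the Dixmier trace, with the factor `1 / log k`. So the
logarithmic means converge, and the choice of `ω` does not matter.
-/

open Filter Topology MeasureTheory

section HilbertBasis

variable {ι H : Type*} [NormedAddCommGroup H] [InnerProductSpace ℂ H]

theorem eq_of_forall_repr_eq (b : HilbertBasis ι ℂ H) {ξ η : H}
    (h : ∀ x, b.repr ξ x = b.repr η x) : ξ = η :=
  b.repr.injective (lp.ext (funext h))

theorem mem_span_of_repr_eq_zero (b : HilbertBasis ι ℂ H) {S : Set ι} (hS : S.Finite) {ξ : H}
    (h : ∀ x ∉ S, b.repr ξ x = 0) : ξ ∈ Submodule.span ℂ (b '' S) := by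
  have h_zero : ∀ x ∉ hS.toFinset, b.repr ξ x • b x = 0 := fun x hx => by
    rw [h x (mt hS.mem_toFinset.2 hx), zero_smul]
  rw [(b.hasSum_repr ξ).unique (hasSum_sum_of_ne_finset_zero h_zero)]
  exact Submodule.sum_mem _ fun x hx => Submodule.smul_mem _ _
    (Submodule.subset_span ⟨x, hS.mem_toFinset.1 hx, rfl⟩)

theorem hasSum_norm_inner_sq (b : HilbertBasis ι ℂ H) (ξ : H) :
    HasSum (fun i => ‖(inner ℂ ξ (b i) : ℂ)‖ ^ 2) (‖ξ‖ ^ 2) := by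
  have h_parseval := b.hasSum_inner_mul_inner ξ ξ
  simp only [← inner_conj_symm (b _) ξ, Complex.mul_conj'] at h_parseval
  rw [inner_self_eq_norm_sq_to_K] at h_parseval
  exact Complex.hasSum_ofReal.1 (by simpa using h_parseval)

end HilbertBasis

/-- `T` is diagonal in the basis `b`: it multiplies the coordinate `x` by `a x`. -/
def IsDiagonal {ι H : Type*} [NormedAddCommGroup H] [InnerProductSpace ℂ H]
    (b : HilbertBasis ι ℂ H) (T : H →L[ℂ] H) (a : ι → ℂ) : Prop :=
  ∀ (ξ : H) (x : ι), b.repr (T ξ) x = a x * b.repr ξ x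

namespace IsDiagonal

section Basic

variable {ι H : Type*} [NormedAddCommGroup H] [InnerProductSpace ℂ H] {b : HilbertBasis ι ℂ H}
  {T S : H →L[ℂ] H} {a c : ι → ℂ}

theorem unique (hT : IsDiagonal b T a) (hS : IsDiagonal b S a) : T = S :=
  ContinuousLinearMap.ext fun ξ => eq_of_forall_repr_eq b fun x => by rw [hT, hS]

theorem congr (hT : IsDiagonal b T a) (h : ∀ x, a x = c x) : IsDiagonal b T c :=
  funext h ▸ hT

theorem apply_basis (hT : IsDiagonal b T a) (x : ι) : T (b x) = a x • b x := by
  classical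
  refine eq_of_forall_repr_eq b fun y => ?_
  rw [hT, b.repr_self, map_smul, b.repr_self, lp.coeFn_smul, Pi.smul_apply, smul_eq_mul]
  by_cases h : y = x
  · rw [h]
  · rw [lp.single_apply_ne _ _ _ h, mul_zero, mul_zero]

theorem norm_le (hT : IsDiagonal b T a) (x : ι) : ‖a x‖ ≤ ‖T‖ := by
  have h := T.le_opNorm (b x)
  rwa [hT.apply_basis, norm_smul, b.orthonormal.1 x, mul_one, mul_one] at h

theorem exists_of_bounded (b : HilbertBasis ι ℂ H) {C : ℝ} (hC : 0 ≤ C)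
    (ha : ∀ x, ‖a x‖ ≤ C) : ∃ T : H →L[ℂ] H, IsDiagonal b T a ∧ ‖T‖ ≤ C := by
  have h_coord : ∀ (ξ : lp (fun _ : ι => ℂ) 2) x, ‖a x * ξ x‖ ≤ ‖((C : ℂ) • ξ) x‖ := by
    intro ξ x
    rw [norm_mul, lp.coeFn_smul, Pi.smul_apply, norm_smul, Complex.norm_of_nonneg hC]
    exact mul_le_mul_of_nonneg_right (ha x) (norm_nonneg _)
  let M : lp (fun _ : ι => ℂ) 2 →ₗ[ℂ] lp (fun _ : ι => ℂ) 2 :=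
    { toFun := fun ξ => ⟨fun x => a x * ξ x, (lp.memℓp ((C : ℂ) • ξ)).mono' (h_coord ξ)⟩
      map_add' := fun ξ η => lp.ext (funext fun x => mul_add _ _ _)
      map_smul' := fun z ξ => lp.ext (funext fun x => mul_left_comm _ _ _) }
  have h_bound : ∀ ξ, ‖M ξ‖ ≤ C * ‖ξ‖ := fun ξ => by
    have h := lp.norm_mono (x := M ξ) two_ne_zero (h_coord ξ)
    rwa [norm_smul, Complex.norm_of_nonneg hC] at h
  refine ⟨LinearMap.mkContinuous (b.repr.symm.toLinearMap ∘ₗ M ∘ₗ b.repr.toLinearMap) C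
    fun ξ => ?_, fun ξ x => ?_, LinearMap.mkContinuous_norm_le _ hC _⟩
  · simpa using h_bound (b.repr ξ)
  · simp [M]

theorem exists_of_norm_le (hT : IsDiagonal b T a) (hc : ∀ x, ‖c x‖ ≤ ‖a x‖) :
    ∃ S : H →L[ℂ] H, IsDiagonal b S c :=
  let ⟨S, hS, _⟩ := exists_of_bounded b (norm_nonneg T) fun x => (hc x).trans (hT.norm_le x)
  ⟨S, hS⟩

theorem one : IsDiagonal b 1 fun _ => 1 := fun _ _ => (one_mul _).symm

theorem zero : IsDiagonal b 0 fun _ => 0 := fun ξ x => by simp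

theorem add (hT : IsDiagonal b T a) (hS : IsDiagonal b S c) :
    IsDiagonal b (T + S) fun x => a x + c x := fun ξ x => by
  simp [hT ξ x, hS ξ x, add_mul]

theorem sub (hT : IsDiagonal b T a) (hS : IsDiagonal b S c) :
    IsDiagonal b (T - S) fun x => a x - c x := fun ξ x => by
  simp [hT ξ x, hS ξ x, sub_mul]

theorem smul (hT : IsDiagonal b T a) (z : ℂ) : IsDiagonal b (z • T) fun x => z * a x :=
  fun ξ x => by simp [hT ξ x, mul_assoc]

theorem mul (hT : IsDiagonal b T a) (hS : IsDiagonal b S c) :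
    IsDiagonal b (T * S) fun x => a x * c x := fun ξ x => by
  rw [mul_apply_eq_comp, hT, hS, mul_assoc]

theorem isCompactOperator_of_finite_support (hT : IsDiagonal b T a)
    (ha : (Function.support a).Finite) : IsCompactOperator T := by
  let E := Submodule.span ℂ (b '' Function.support a)
  have hE : FiniteDimensional ℂ E := FiniteDimensional.span_of_finite ℂ (ha.image _)
  have h_range : ∀ ξ, T ξ ∈ E := fun ξ => mem_span_of_repr_eq_zero b ha fun x hx => by
    rw [hT, Function.notMem_support.1 hx, zero_mul]
  have h_id : IsCompactOperator (ContinuousLinearMap.id ℂ E) :=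
    isCompactOperator_id_iff_finiteDimensional.2 hE
  exact (h_id.comp_clm (T.codRestrict E h_range)).clm_comp E.subtypeL

theorem exists_norm_sub_le (hT : IsDiagonal b T a) (ha : Tendsto a cofinite (𝓝 0)) {ε : ℝ}
    (hε : 0 < ε) : ∃ S : H →L[ℂ] H, IsCompactOperator S ∧ ‖T - S‖ ≤ ε := by
  classical
  have h_fin : {x | ¬ ‖a x‖ < ε}.Finite := by
    simpa only [dist_zero_right, eventually_cofinite] using Metric.tendsto_nhds.1 ha ε hε
  obtain ⟨R, hR, hR_norm⟩ := exists_of_bounded b (a := fun x => if ‖a x‖ < ε then a x else 0)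
    hε.le fun x => by
      split_ifs with h
      exacts [h.le, norm_zero.trans_le hε.le]
  refine ⟨T - R, (hT.sub hR).isCompactOperator_of_finite_support (h_fin.subset fun x hx h => ?_),
    by rwa [sub_sub_cancel]⟩
  exact hx (by simp only [if_pos h, sub_self])

theorem hasSum_inner_self (hT : IsDiagonal b T a) (ξ : H) :
    HasSum (fun x => a x * (‖(inner ℂ (b x) ξ : ℂ)‖ ^ 2 : ℝ)) (inner ℂ ξ (T ξ)) := by
  have h := lp.hasSum_inner (𝕜 := ℂ) (b.repr ξ) (b.repr (T ξ))
  rw [b.repr.inner_map_map] at h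
  refine h.congr_fun fun x => ?_
  rw [hT, RCLike.inner_apply, mul_assoc, RCLike.mul_conj, b.repr_apply_apply]
  norm_cast

theorem hasSum_inner (hT : IsDiagonal b T a) (ha : Summable fun x => ‖a x‖) {κ : Type*}
    (c : HilbertBasis κ ℂ H) :
    HasSum (fun i => (inner ℂ (c i) (T (c i)) : ℂ)) (∑' x, a x) := by
  let G : ι × κ → ℂ := fun p => a p.1 * (‖(inner ℂ (b p.1) (c p.2) : ℂ)‖ ^ 2 : ℝ)
  have h_parseval : ∀ x, HasSum (fun i => ‖(inner ℂ (b x) (c i) : ℂ)‖ ^ 2) 1 := fun x => by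
    simpa [b.orthonormal.1 x] using hasSum_norm_inner_sq c (b x)
  have h_row : ∀ x, HasSum (fun i => G (x, i)) (a x) := fun x => by
    simpa [G] using (Complex.hasSum_ofReal.2 (h_parseval x)).mul_left (a x)
  have h_norm_row : ∀ x, HasSum (fun i => ‖G (x, i)‖) ‖a x‖ := fun x => by
    simpa [G] using (h_parseval x).mul_left ‖a x‖
  have hG : Summable G := by
    refine Summable.of_norm ((summable_prod_of_nonneg fun _ => norm_nonneg _).2
      ⟨fun x => (h_norm_row x).summable, ?_⟩)
    simpa only [fun x => (h_norm_row x).tsum_eq] using ha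
  have hG_sum : HasSum G (∑' x, a x) := (hG.hasSum.prod_fiberwise h_row).tsum_eq ▸ hG.hasSum
  exact ((Equiv.prodComm κ ι).hasSum_iff.2 hG_sum).prod_fiberwise
    fun i => hT.hasSum_inner_self (c i)

end Basic

section Complete

variable {ι H : Type*} [NormedAddCommGroup H] [InnerProductSpace ℂ H] [CompleteSpace H]
  {b : HilbertBasis ι ℂ H} {T : H →L[ℂ] H} {a : ι → ℂ}

theorem isCompactOperator (hT : IsDiagonal b T a) (ha : Tendsto a cofinite (𝓝 0)) :
    IsCompactOperator T := by
  choose S hS hTS using fun n : ℕ => hT.exists_norm_sub_le ha (Nat.one_div_pos_of_nat (n := n))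
  refine isCompactOperator_of_tendsto (l := atTop) (F := S) ?_ (Eventually.of_forall hS)
  rw [tendsto_iff_norm_sub_tendsto_zero]
  exact squeeze_zero (fun _ => norm_nonneg _) (fun n => norm_sub_rev T (S n) ▸ hTS n)
    tendsto_one_div_add_atTop_nhds_zero_nat

protected theorem star (hT : IsDiagonal b T a) : IsDiagonal b (star T) fun x => star (a x) := by
  obtain ⟨S, hS⟩ := hT.exists_of_norm_le (c := fun x => star (a x)) (by simp)
  suffices star T = S by rwa [this]
  rw [ContinuousLinearMap.star_eq_adjoint, eq_comm, ContinuousLinearMap.eq_adjoint_iff]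
  intro ξ η
  rw [← b.repr.inner_map_map, ← b.repr.inner_map_map ξ, lp.inner_eq_tsum, lp.inner_eq_tsum]
  refine tsum_congr fun x => ?_
  rw [hT, hS]
  simp only [RCLike.inner_apply, map_mul, RCLike.star_def, RCLike.conj_conj]
  ring

theorem isSelfAdjoint {a : ι → ℝ} (hT : IsDiagonal b T fun x => (a x : ℂ)) : IsSelfAdjoint T :=
  hT.star.unique (hT.congr fun x => (Complex.conj_ofReal (a x)).symm)

theorem nonneg {a : ι → ℝ} (hT : IsDiagonal b T fun x => (a x : ℂ)) (ha : ∀ x, 0 ≤ a x) :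
    0 ≤ T := by
  obtain ⟨S, hS, -⟩ := exists_of_bounded b (a := fun x => (√(a x) : ℂ)) (Real.sqrt_nonneg ‖T‖)
    fun x => by
      rw [Complex.norm_of_nonneg (Real.sqrt_nonneg _)]
      exact Real.sqrt_le_sqrt (Complex.norm_of_nonneg (ha x) ▸ hT.norm_le x)
  have h_square : T = star S * S := hT.unique ((hS.star.mul hS).congr fun x => by
    rw [RCLike.star_def, Complex.conj_ofReal, ← Complex.ofReal_mul, Real.mul_self_sqrt (ha x)])
  exact h_square ▸ star_mul_self_nonneg S

theorem abs_of_star_mul_self {a : ι → ℝ} (ha : ∀ x, 0 ≤ a x)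
    (hT : IsDiagonal b (star T * T) fun x => (a x * a x : ℂ)) :
    IsDiagonal b (CFC.abs T) fun x => (a x : ℂ) := by
  obtain ⟨S, hS, -⟩ := exists_of_bounded b (a := fun x => (a x : ℂ)) (norm_nonneg T) fun x => by
    have h := hT.norm_le x
    rw [CStarRing.norm_star_mul_self, norm_mul, Complex.norm_of_nonneg (ha x)] at h
    rw [Complex.norm_of_nonneg (ha x)]
    exact abs_le_of_sq_le_sq' (by linarith) (norm_nonneg T) |>.2
  rwa [show CFC.abs T = S from CFC.sqrt_unique ((hS.mul hS).unique hT) (hS.nonneg ha)]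

protected theorem abs (hT : IsDiagonal b T a) : IsDiagonal b (CFC.abs T) fun x => (‖a x‖ : ℂ) :=
  abs_of_star_mul_self (fun x => norm_nonneg _) <| (hT.star.mul hT).congr fun x => by
    rw [RCLike.star_def, Complex.conj_mul', sq]

theorem posPart {a : ι → ℝ} (hT : IsDiagonal b T fun x => (a x : ℂ)) :
    IsDiagonal b T⁺ fun x => (((a x)⁺ : ℝ) : ℂ) := by
  have h : T⁺ = (2⁻¹ : ℂ) • (CFC.abs T + T) := by
    rw [CFC.abs_add_self T hT.isSelfAdjoint, ← Nat.cast_smul_eq_nsmul ℂ, Nat.cast_ofNat,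
      inv_smul_smul₀ two_ne_zero]
  rw [h]
  refine ((hT.abs.add hT).smul _).congr fun x => ?_
  rw [Complex.norm_real, Real.norm_eq_abs, ← Complex.ofReal_add, abs_add_eq_two_nsmul_posPart]
  simp

theorem negPart {a : ι → ℝ} (hT : IsDiagonal b T fun x => (a x : ℂ)) :
    IsDiagonal b T⁻ fun x => (((a x)⁻ : ℝ) : ℂ) := by
  have h := (hT.smul (-1)).congr (c := fun x => ((-a x : ℝ) : ℂ)) fun x => by simp
  simpa using h.posPart

theorem realPart (hT : IsDiagonal b T a) :
    IsDiagonal b (ℜ T : H →L[ℂ] H) fun x => ((a x).re : ℂ) := by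
  rw [realPart_apply_coe, ← Complex.coe_smul]
  refine ((hT.add hT.star).smul _).congr fun x => ?_
  rw [RCLike.star_def, Complex.re_eq_add_conj, Complex.ofReal_inv, Complex.ofReal_ofNat]
  ring

theorem imaginaryPart (hT : IsDiagonal b T a) :
    IsDiagonal b (ℑ T : H →L[ℂ] H) fun x => ((a x).im : ℂ) := by
  rw [imaginaryPart_apply_coe, ← Complex.coe_smul]
  refine (((hT.sub hT.star).smul _).smul _).congr fun x => ?_
  rw [RCLike.star_def, Complex.im_eq_sub_conj, Complex.ofReal_inv, Complex.ofReal_ofNat,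
    div_eq_mul_inv, mul_inv, Complex.inv_I]
  ring

end Complete

end IsDiagonal

section FunctionalCalculus

variable {ι H : Type*} [NormedAddCommGroup H] [InnerProductSpace ℂ H]

theorem exists_isDiagonal_lp (b : HilbertBasis ι ℂ H) (a : lp (fun _ : ι => ℂ) ∞) :
    ∃ T : H →L[ℂ] H, IsDiagonal b T a ∧ ‖T‖ ≤ ‖a‖ :=
  IsDiagonal.exists_of_bounded b (norm_nonneg a) (lp.norm_apply_le_norm ENNReal.top_ne_zero a)

variable [CompleteSpace H] {b : HilbertBasis ι ℂ H} {T : H →L[ℂ] H} {a : ι → ℂ}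

/-- The representation of `ℓ^∞(ι)` by diagonal operators, as a star algebra homomorphism; it
carries the functional calculus of `ℓ^∞(ι)` over to diagonal operators. -/
noncomputable def diagonalHom (b : HilbertBasis ι ℂ H) :
    lp (fun _ : ι => ℂ) ∞ →⋆ₐ[ℂ] (H →L[ℂ] H) where
  toFun a := (exists_isDiagonal_lp b a).choose
  map_one' := (exists_isDiagonal_lp b 1).choose_spec.1.unique .one
  map_mul' a c := (exists_isDiagonal_lp b (a * c)).choose_spec.1.unique <|
    (exists_isDiagonal_lp b a).choose_spec.1.mul (exists_isDiagonal_lp b c).choose_spec.1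
  map_zero' := (exists_isDiagonal_lp b 0).choose_spec.1.unique .zero
  map_add' a c := (exists_isDiagonal_lp b (a + c)).choose_spec.1.unique <|
    (exists_isDiagonal_lp b a).choose_spec.1.add (exists_isDiagonal_lp b c).choose_spec.1
  commutes' z := (exists_isDiagonal_lp b _).choose_spec.1.unique <| by
    rw [Algebra.algebraMap_eq_smul_one]
    exact (IsDiagonal.one.smul z).congr fun _ => mul_one z
  map_star' a := (exists_isDiagonal_lp b (star a)).choose_spec.1.unique
    (exists_isDiagonal_lp b a).choose_spec.1.star

theorem isDiagonal_diagonalHom (b : HilbertBasis ι ℂ H) (a : lp (fun _ : ι => ℂ) ∞) :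
    IsDiagonal b (diagonalHom b a) a :=
  (exists_isDiagonal_lp b a).choose_spec.1

theorem continuous_diagonalHom (b : HilbertBasis ι ℂ H) : Continuous (diagonalHom b) :=
  AddMonoidHomClass.continuous_of_bound (diagonalHom b) 1 fun a => by
    rw [one_mul]
    exact (exists_isDiagonal_lp b a).choose_spec.2

/-- Evaluation at a coordinate, as a character of `ℓ^∞(ι)`. -/
def lpEvalHom (x : ι) : lp (fun _ : ι => ℂ) ∞ →⋆ₐ[ℂ] ℂ where
  toFun a := a x
  map_one' := rfl
  map_mul' _ _ := rfl
  map_zero' := rfl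
  map_add' _ _ := rfl
  commutes' _ := rfl
  map_star' _ := rfl

theorem spectrum_lp_subset {a : lp (fun _ : ι => ℂ) ∞} {s : Set ℂ} (hs : IsClosed s)
    (ha : ∀ x, a x ∈ s) : spectrum ℂ a ⊆ s := by
  intro z hz
  by_contra hzs
  obtain ⟨ε, hε, hball⟩ := Metric.isOpen_iff.1 hs.isOpen_compl z hzs
  have h_dist : ∀ x, ε ≤ ‖z - a x‖ := fun x => by
    by_contra! h
    exact hball (by rwa [Metric.mem_ball, dist_comm, dist_eq_norm]) (ha x)
  let c : lp (fun _ : ι => ℂ) ∞ := ⟨fun x => (z - a x)⁻¹, memℓp_infty ⟨ε⁻¹, by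
    rintro _ ⟨x, rfl⟩
    simpa only [norm_inv] using inv_anti₀ hε (h_dist x)⟩⟩
  refine hz (IsUnit.of_mul_eq_one c ?_)
  ext x
  exact mul_inv_cancel₀ (norm_pos_iff.1 (hε.trans_le (h_dist x)))

theorem cfc_lp_apply {a : lp (fun _ : ι => ℂ) ∞} {f : ℂ → ℂ} (hf : ContinuousOn f (spectrum ℂ a))
    (x : ι) : cfc f a x = f (a x) :=
  (StarAlgHom.map_cfc (lpEvalHom x) f a hf
    (lp.lipschitzWith_one_eval (E := fun _ : ι => ℂ) ∞ x).continuous).trans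
      (cfc_algebraMap (A := ℂ) (a x) f)

protected theorem IsDiagonal.cfc (hT : IsDiagonal b T a) {f : ℂ → ℂ} {s : Set ℂ}
    (hf : ContinuousOn f s) (hs : IsClosed s) (ha : ∀ x, a x ∈ s) :
    IsDiagonal b (cfc f T) fun x => f (a x) := by
  let A : lp (fun _ : ι => ℂ) ∞ := ⟨a, memℓp_infty ⟨‖T‖, Set.forall_mem_range.2 hT.norm_le⟩⟩
  have hfA : ContinuousOn f (spectrum ℂ A) := hf.mono (spectrum_lp_subset hs ha)
  rw [hT.unique (isDiagonal_diagonalHom b A),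
    ← StarAlgHom.map_cfc (diagonalHom b) f A hfA (continuous_diagonalHom b)]
  exact (isDiagonal_diagonalHom b _).congr fun x => cfc_lp_apply hfA x

end FunctionalCalculus

section Trace

universe u

variable {ι H : Type u} [NormedAddCommGroup H] [InnerProductSpace ℂ H] [CompleteSpace H]
  {b : HilbertBasis ι ℂ H} {T : H →L[ℂ] H} {a : ι → ℂ}

theorem IsDiagonal.isTraceClass_iff (hT : IsDiagonal b T a) :
    IsTraceClass T ↔ Summable fun x => ‖a x‖ := by
  refine ⟨fun h => ?_, fun h κ c => (hT.abs.hasSum_inner (by simpa using h) c).summable⟩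
  have h_diag : ∀ x, inner ℂ (b x) (CFC.abs T (b x)) = (‖a x‖ : ℂ) := fun x => by
    rw [hT.abs.apply_basis, inner_smul_right, inner_self_eq_norm_sq_to_K, b.orthonormal.1]
    simp
  have h_sum := h ι b
  simp only [h_diag] at h_sum
  exact_mod_cast h_sum

theorem IsDiagonal.opTrace_eq (hT : IsDiagonal b T a) (ha : Summable fun x => ‖a x‖) :
    opTrace T = ∑' x, a x :=
  (hT.hasSum_inner ha _).tsum_eq

end Trace

section SingularValues

universe u

variable {ι H : Type u} [NormedAddCommGroup H] [InnerProductSpace ℂ H] {b : HilbertBasis ι ℂ H}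
  {T : H →L[ℂ] H}

theorem IsDiagonal.eigenspace_le_span {a : ι → ℂ} (hT : IsDiagonal b T a) {S : Set ι}
    (hS : S.Finite) {r : ℂ} (hr : ∀ x, a x = r → x ∈ S) :
    Module.End.eigenspace T.toLinearMap r ≤ Submodule.span ℂ (b '' S) := by
  intro ξ hξ
  refine mem_span_of_repr_eq_zero b hS fun x hx => ?_
  have h_eigen : T ξ = r • ξ := Module.End.mem_eigenspace_iff.1 hξ
  have h_coord : r * b.repr ξ x = a x * b.repr ξ x := by
    rw [← hT, h_eigen, map_smul, lp.coeFn_smul, Pi.smul_apply, smul_eq_mul]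
  by_contra h0
  exact hx (hr x (mul_right_cancel₀ h0 h_coord).symm)

theorem IsDiagonal.rank_iSup_eigenspace_le_iff {a : ι → ℝ}
    (hT : IsDiagonal b T fun x => (a x : ℂ)) (t : ℝ) (j : ℕ) :
    Module.rank ℂ (⨆ (r : ℝ) (_ : t < r), Module.End.eigenspace T.toLinearMap (r : ℂ) :
        Submodule ℂ H) ≤ j ↔ Cardinal.mk {x | t < a x} ≤ j := by
  refine ⟨fun h => le_trans ?_ h, fun h => ?_⟩
  · let v : {x | t < a x} → (⨆ (r : ℝ) (_ : t < r),
        Module.End.eigenspace T.toLinearMap (r : ℂ) : Submodule ℂ H) := fun x =>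
      ⟨b x, Submodule.mem_iSup_of_mem (a x) <| Submodule.mem_iSup_of_mem x.2 <|
        Module.End.mem_eigenspace_iff.2 (hT.apply_basis x)⟩
    have hv : LinearIndependent ℂ v := .of_comp (Submodule.subtype _)
      (b.orthonormal.linearIndependent.comp _ Subtype.val_injective)
    exact hv.cardinal_le_rank
  · have h_fin : {x | t < a x}.Finite :=
      Cardinal.lt_aleph0_iff_set_finite.1 (h.trans_lt Cardinal.natCast_lt_aleph0)
    have h_le : (⨆ (r : ℝ) (_ : t < r), Module.End.eigenspace T.toLinearMap (r : ℂ) :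
        Submodule ℂ H) ≤ Submodule.span ℂ (b '' {x | t < a x}) :=
      iSup₂_le fun r hr => hT.eigenspace_le_span h_fin fun x hx =>
        hr.trans_eq (Complex.ofReal_injective hx).symm
    exact (Submodule.rank_mono h_le).trans ((rank_span_le _).trans (Cardinal.mk_image_le.trans h))

variable [CompleteSpace H] {a : ι → ℂ}

theorem IsDiagonal.singVal_eq (hT : IsDiagonal b T a) (j : ℕ) :
    singVal T j = sInf {t : ℝ | 0 ≤ t ∧ Cardinal.mk {x | t < ‖a x‖} ≤ j} :=
  congrArg sInf <| Set.ext fun t =>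
    and_congr_right fun _ => hT.abs.rank_iSup_eigenspace_le_iff t j

theorem singVal_nonneg (T : H →L[ℂ] H) (j : ℕ) : 0 ≤ singVal T j :=
  Real.sInf_nonneg fun _ ht => ht.1

theorem IsDiagonal.singVal_le (hT : IsDiagonal b T a) {t : ℝ} (ht : 0 ≤ t) {B : Finset ι} {j : ℕ}
    (hj : B.card ≤ j) (hB : ∀ x ∉ B, ‖a x‖ ≤ t) : singVal T j ≤ t := by
  rw [hT.singVal_eq]
  refine csInf_le ⟨0, fun _ hs => hs.1⟩ ⟨ht, ?_⟩
  have h_sub : {x | t < ‖a x‖} ⊆ (B : Set ι) := fun x hx => by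
    by_contra h
    exact (hB x h).not_gt hx
  refine (Cardinal.mk_le_mk_of_subset h_sub).trans ?_
  rw [Finset.coe_sort_coe, Cardinal.mk_coe_finset]
  exact_mod_cast hj

theorem IsDiagonal.le_singVal (hT : IsDiagonal b T a) {t : ℝ} {B : Finset ι} {j : ℕ}
    (hj : j < B.card) (hB : ∀ x ∈ B, t ≤ ‖a x‖) : t ≤ singVal T j := by
  rw [hT.singVal_eq]
  refine le_csInf ⟨‖T‖, norm_nonneg T, ?_⟩ fun s hs => ?_
  · have h_empty : {x | ‖T‖ < ‖a x‖} = ∅ :=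
      Set.eq_empty_of_forall_notMem fun x hx => (hT.norm_le x).not_gt hx
    rw [h_empty, Cardinal.mk_eq_zero]
    exact zero_le
  · by_contra! h_lt
    have h_card : Cardinal.mk (B : Set ι) ≤ j :=
      (Cardinal.mk_le_mk_of_subset fun x hx => h_lt.trans_le (hB x hx)).trans hs.2
    rw [Finset.coe_sort_coe, Cardinal.mk_coe_finset] at h_card
    exact hj.not_ge (by exact_mod_cast h_card)

theorem singSum_succ (T : H →L[ℂ] H) (n : ℕ) : singSum T (n + 1) = singSum T n + singVal T n :=
  Finset.sum_range_succ _ _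

theorem singSum_mono (T : H →L[ℂ] H) : Monotone (singSum T) :=
  monotone_nat_of_le_succ fun n => by
    rw [singSum_succ]
    exact le_add_of_nonneg_right (singVal_nonneg T n)

theorem IsDiagonal.sum_le_singSum (hT : IsDiagonal b T a) (B : Finset ι) :
    ∑ x ∈ B, ‖a x‖ ≤ singSum T B.card := by
  classical
  induction hn : B.card generalizing B with
  | zero => rw [Finset.card_eq_zero.1 hn]; simp [singSum]
  | succ n ih =>
    obtain ⟨x, hx, h_min⟩ := B.exists_min_image (‖a ·‖) (Finset.card_pos.1 (by omega))
    rw [singSum_succ, ← Finset.sum_erase_add _ _ hx]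
    exact add_le_add (ih (B.erase x) (by rw [Finset.card_erase_of_mem hx, hn, Nat.add_sub_cancel]))
      (hT.le_singVal (by omega) h_min)

theorem IsDiagonal.singSum_card_le (hT : IsDiagonal b T a) {β : ℝ} (hβ : 0 ≤ β) {B : Finset ι}
    (hB : ∀ x ∈ B, ∀ y ∉ B, ‖a y‖ ≤ ‖a x‖ + β) :
    singSum T B.card ≤ ∑ x ∈ B, (‖a x‖ + β) := by
  classical
  induction hn : B.card generalizing B with
  | zero => rw [Finset.card_eq_zero.1 hn]; simp [singSum]
  | succ n ih =>
    obtain ⟨x, hx, h_min⟩ := B.exists_min_image (‖a ·‖) (Finset.card_pos.1 (by omega))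
    have h_card : (B.erase x).card = n := by
      rw [Finset.card_erase_of_mem hx, hn, Nat.add_sub_cancel]
    have h_erase : ∀ y ∉ B.erase x, ‖a y‖ ≤ ‖a x‖ + β := fun y hy => by
      by_cases hyB : y ∈ B
      · obtain rfl : y = x := by simpa [hyB] using hy
        exact le_add_of_nonneg_right hβ
      · exact hB x hx y hyB
    rw [singSum_succ, ← Finset.sum_erase_add _ _ hx]
    refine add_le_add (ih (fun z hz y hy => (h_erase y hy).trans ?_) h_card)
      (hT.singVal_le (by positivity) h_card.le h_erase)
    exact add_le_add_left (h_min z (Finset.mem_of_mem_erase hz)) β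

theorem IsDiagonal.singSum_le (hT : IsDiagonal b T a) {β : ℝ} (hβ : 0 ≤ β) {B : Finset ι}
    (hB : ∀ x ∉ B, ‖a x‖ ≤ β) {n : ℕ} (hn : B.card ≤ n) :
    singSum T n ≤ ∑ x ∈ B, ‖a x‖ + n * β := by
  induction n, hn using Nat.le_induction with
  | base =>
    refine (hT.singSum_card_le hβ fun x _ y hy => (hB y hy).trans ?_).trans_eq ?_
    · exact le_add_of_nonneg_left (norm_nonneg _)
    · rw [Finset.sum_add_distrib, Finset.sum_const, nsmul_eq_mul]
  | succ n hn ih =>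
    rw [singSum_succ]
    push_cast
    linarith [hT.singVal_le hβ hn hB]

end SingularValues

section MonotoneRatio

variable {c : ℕ → ℕ}

theorem exists_tendsto_atTop_le_lt_succ (hc : StrictMono c) :
    ∃ ν : ℕ → ℕ, Tendsto ν atTop atTop ∧ ∀ m, c 0 ≤ m → c (ν m) ≤ m ∧ m < c (ν m + 1) := by
  refine ⟨fun m => Nat.findGreatest (fun n => c n ≤ m) m, tendsto_atTop.2 fun n => ?_,
    fun m hm => ⟨Nat.findGreatest_spec (P := fun n => c n ≤ m) m.zero_le hm, ?_⟩⟩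
  · filter_upwards [eventually_ge_atTop (c n)] with m hm
    exact Nat.le_findGreatest ((hc.le_apply).trans hm) hm
  · by_contra! h
    exact absurd (Nat.le_findGreatest (hc.le_apply.trans h) h) (Nat.lt_succ_self _).not_ge

theorem tendsto_div_of_monotone {u : ℕ → ℝ} (hu : Monotone u) {L : ℝ}
    (hL : Tendsto (fun n => u (c n) / n) atTop (𝓝 L)) {ν : ℕ → ℕ} (hν : Tendsto ν atTop atTop)
    (hcν : ∀ m, c 0 ≤ m → c (ν m) ≤ m ∧ m < c (ν m + 1)) :
    Tendsto (fun m => u m / ν m) atTop (𝓝 L) := by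
  have h_succ : Tendsto (fun n => u (c (n + 1)) / n) atTop (𝓝 L) := by
    have h_ratio : Tendsto (fun n : ℕ => ((n + 1 : ℕ) : ℝ) / n) atTop (𝓝 1) := by
      simpa using (tendsto_natCast_div_add_atTop (1 : ℝ)).inv₀ one_ne_zero
    have h_mul := (hL.comp (tendsto_add_atTop_nat 1)).mul h_ratio
    rw [mul_one] at h_mul
    refine h_mul.congr fun n => ?_
    exact div_mul_div_cancel₀ (Nat.cast_ne_zero.2 n.succ_ne_zero)
  refine tendsto_of_tendsto_of_tendsto_of_le_of_le' (hL.comp hν) (h_succ.comp hν) ?_ ?_ <;>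
    filter_upwards [eventually_ge_atTop (c 0)] with m hm
  · exact div_le_div_of_nonneg_right (hu (hcν m hm).1) (Nat.cast_nonneg _)
  · exact div_le_div_of_nonneg_right (hu (hcν m hm).2.le) (Nat.cast_nonneg _)

theorem tendsto_div_of_monotone_of_strictMono {u v : ℕ → ℝ} (hu : Monotone u) (hv : Monotone v)
    (hc : StrictMono c) {L M : ℝ} (hM : M ≠ 0) (hL : Tendsto (fun n => u (c n) / n) atTop (𝓝 L))
    (hvM : Tendsto (fun n => v (c n) / n) atTop (𝓝 M)) :
    Tendsto (fun m => u m / v m) atTop (𝓝 (L / M)) := by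
  obtain ⟨ν, hν, hcν⟩ := exists_tendsto_atTop_le_lt_succ hc
  refine ((tendsto_div_of_monotone hu hL hν hcν).div
    (tendsto_div_of_monotone hv hvM hν hcν) hM).congr' ?_
  filter_upwards [hν.eventually_ne_atTop 0] with m hm
  exact div_div_div_cancel_right₀ (Nat.cast_ne_zero.2 hm) _ _

end MonotoneRatio

section DixmierTrace

universe u

variable {ι H : Type u} [NormedAddCommGroup H] [InnerProductSpace ℂ H] [CompleteSpace H]
  {b : HilbertBasis ι ℂ H} {T : H →L[ℂ] H} {a : ι → ℂ}

theorem monotone_log_natCast : Monotone fun n : ℕ => Real.log n := fun m n h => by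
  rcases m.eq_zero_or_pos with rfl | hm
  · simpa using Real.log_natCast_nonneg n
  · exact Real.log_le_log (Nat.cast_pos.2 hm) (Nat.cast_le.2 h)

theorem IsDiagonal.tendsto_logMean (hT : IsDiagonal b T a) {c : ℕ → ℕ} (hc : StrictMono c)
    {B : ℕ → Finset ι} (hBc : ∀ n, (B n).card ≤ c n) {C : ℝ}
    (hB : ∀ n, ∀ x ∉ B n, c n * ‖a x‖ ≤ C) {L M : ℝ} (hM : M ≠ 0)
    (hL : Tendsto (fun n : ℕ => (∑ x ∈ B n, ‖a x‖) / n) atTop (𝓝 L))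
    (hcM : Tendsto (fun n : ℕ => Real.log (c n) / n) atTop (𝓝 M)) :
    Tendsto (logMean T) atTop (𝓝 (L / M)) := by
  refine tendsto_div_of_monotone_of_strictMono (singSum_mono T) monotone_log_natCast hc hM ?_ hcM
  have h_upper : Tendsto (fun n : ℕ => (∑ x ∈ B n, ‖a x‖) / n + |C| / n) atTop (𝓝 L) := by
    simpa using hL.add (tendsto_natCast_atTop_atTop.const_div_atTop |C|)
  refine tendsto_of_tendsto_of_tendsto_of_le_of_le' hL h_upper ?_ ?_ <;>
    filter_upwards [eventually_gt_atTop 0] with n hn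
  · exact div_le_div_of_nonneg_right
      ((hT.sum_le_singSum _).trans (singSum_mono T (hBc n))) n.cast_nonneg
  · have hcn : (0 : ℝ) < c n := Nat.cast_pos.2 (hn.trans_le hc.le_apply)
    have h_tail : ∀ x ∉ B n, ‖a x‖ ≤ |C| / c n := fun x hx => by
      rw [le_div_iff₀' hcn]
      exact (hB n x hx).trans (le_abs_self C)
    rw [← add_div]
    refine div_le_div_of_nonneg_right ?_ n.cast_nonneg
    refine (hT.singSum_le (by positivity) h_tail (hBc n)).trans_eq ?_
    rw [mul_div_cancel₀ _ hcn.ne']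

theorem exists_norm_logMean_le_of_tendsto {L : ℝ} (h : Tendsto (logMean T) atTop (𝓝 L)) :
    ∃ C : ℝ, ∀ n, ‖logMean T n‖ ≤ C := by
  obtain ⟨C, hC⟩ := (Metric.isBounded_range_of_tendsto _ h).exists_norm_le
  exact ⟨C, fun n => hC _ ⟨n, rfl⟩⟩

theorem dixmierPos_eq_of_tendsto (ω : GeneralizedLimit) {L : ℝ}
    (h : Tendsto (logMean T) atTop (𝓝 L)) : dixmierPos ω T = L := by
  rw [dixmierPos, dif_pos (exists_norm_logMean_le_of_tendsto h)]
  exact ω.eq_limit _ _ h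

theorem IsDiagonal.dixmierTrace_eq (ω : GeneralizedLimit) (hT : IsDiagonal b T a)
    {L₁ L₂ L₃ L₄ : ℝ}
    (h₁ : ∀ S, IsDiagonal b S (fun x => (((a x).re⁺ : ℝ) : ℂ)) →
      Tendsto (logMean S) atTop (𝓝 L₁))
    (h₂ : ∀ S, IsDiagonal b S (fun x => (((-(a x).re)⁺ : ℝ) : ℂ)) →
      Tendsto (logMean S) atTop (𝓝 L₂))
    (h₃ : ∀ S, IsDiagonal b S (fun x => (((a x).im⁺ : ℝ) : ℂ)) →
      Tendsto (logMean S) atTop (𝓝 L₃))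
    (h₄ : ∀ S, IsDiagonal b S (fun x => (((-(a x).im)⁺ : ℝ) : ℂ)) →
      Tendsto (logMean S) atTop (𝓝 L₄)) :
    dixmierTrace ω T = ((L₁ - L₂ : ℝ) : ℂ) + Complex.I * ((L₃ - L₄ : ℝ) : ℂ) := by
  simp only [posPart_neg] at h₂ h₄
  rw [dixmierTrace, dixmierPos_eq_of_tendsto ω (h₁ _ hT.realPart.posPart),
    dixmierPos_eq_of_tendsto ω (h₂ _ hT.realPart.negPart),
    dixmierPos_eq_of_tendsto ω (h₃ _ hT.imaginaryPart.posPart),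
    dixmierPos_eq_of_tendsto ω (h₄ _ hT.imaginaryPart.negPart)]

end DixmierTrace

section BoundedInverse

universe u

variable {ι H : Type u} [NormedAddCommGroup H] [InnerProductSpace ℂ H]
  {b : HilbertBasis ι ℂ H} {D : H →ₗ.[ℂ] H} {B : H →L[ℂ] H}

theorem boundedInverse_eq (hB : IsBoundedInverse D B) : boundedInverse D = B := by
  have h : ∃ B, IsBoundedInverse D B := ⟨B, hB⟩
  rw [boundedInverse, dif_pos h]
  ext y
  exact (h.choose_spec (B y, y)).1 ((hB (B y, y)).2 rfl)

variable [CompleteSpace H] {ℓ : ι → ℝ} {r : ι → ι}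

theorem isDiagonal_star_mul_self_of_involutive (hr : Function.Involutive r)
    (hℓ : ∀ x, ℓ (r x) = ℓ x) (hB : ∀ ξ x, b.repr (B ξ) x = ℓ x * b.repr ξ (r x)) :
    IsDiagonal b (star B * B) fun x => (ℓ x * ℓ x : ℂ) := by
  have h_star : star B = B := by
    rw [ContinuousLinearMap.star_eq_adjoint, eq_comm, ContinuousLinearMap.eq_adjoint_iff]
    intro ξ η
    rw [← b.repr.inner_map_map, ← b.repr.inner_map_map ξ, lp.inner_eq_tsum, lp.inner_eq_tsum,
      ← (hr.toPerm r).tsum_eq]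
    refine tsum_congr fun x => ?_
    simp only [Function.Involutive.coe_toPerm, hB, hr x, hℓ, RCLike.inner_apply, map_mul,
      Complex.conj_ofReal]
    ring
  intro ξ x
  rw [h_star, mul_apply_eq_comp, hB, hB, hr x, hℓ, mul_assoc]

theorem isDiagonal_absNegPow (hD : IsBoundedInverse D B) (hr : Function.Involutive r)
    (hℓ : ∀ x, ℓ (r x) = ℓ x) (hB : ∀ ξ x, b.repr (B ξ) x = ℓ x * b.repr ξ (r x))
    (hℓ₀ : ∀ x, 0 ≤ ℓ x) {s : ℂ} (hs : 0 < s.re) :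
    IsDiagonal b (absNegPow D s) fun x => (ℓ x : ℂ) ^ s := by
  have h_abs : IsDiagonal b (CFC.abs B) fun x => (ℓ x : ℂ) :=
    .abs_of_star_mul_self hℓ₀ (isDiagonal_star_mul_self_of_involutive hr hℓ hB)
  rw [absNegPow, boundedInverse_eq hD]
  refine h_abs.cfc (s := {z : ℂ | 0 ≤ z.re})
    (fun z hz => (Complex.continuousAt_cpow_const_of_re_pos (.inl hz) hs).continuousWithinAt)
    (isClosed_le continuous_const Complex.continuous_re) hℓ₀

end BoundedInverse

section Similarity

variable {X Y : Type*} [MetricSpace X] [MetricSpace Y] {r : ℝ} {f : X → Y}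

theorem injective_of_dist_eq_mul (hr : 0 < r) (hf : ∀ x y, dist (f x) (f y) = r * dist x y) :
    Function.Injective f := fun x y h => by
  have h₀ : r * dist x y = 0 := by rw [← hf, h, dist_self]
  exact dist_eq_zero.1 ((mul_eq_zero.1 h₀).resolve_left hr.ne')

theorem lipschitzWith_of_dist_eq_mul (hr : 0 < r) (hf : ∀ x y, dist (f x) (f y) = r * dist x y) :
    LipschitzWith r.toNNReal f :=
  LipschitzWith.of_dist_le_mul fun x y => by rw [hf, Real.coe_toNNReal _ hr.le]

theorem antilipschitzWith_of_dist_eq_mul (hr : 0 < r)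
    (hf : ∀ x y, dist (f x) (f y) = r * dist x y) : AntilipschitzWith r⁻¹.toNNReal f :=
  AntilipschitzWith.of_le_mul_dist fun x y => by
    rw [hf, Real.coe_toNNReal _ (inv_nonneg.2 hr.le), inv_mul_cancel_left₀ hr.ne']

theorem surjective_of_dist_eq_mul {E : Type*} [NormedAddCommGroup E] [NormedSpace ℝ E]
    [StrictConvexSpace ℝ E] [FiniteDimensional ℝ E] {f : E → E} (hr : 0 < r)
    (hf : ∀ x y, dist (f x) (f y) = r * dist x y) : Function.Surjective f := by
  have hi : Isometry fun x => r⁻¹ • f x := Isometry.of_dist_eq fun x y => by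
    rw [dist_smul₀, hf, Real.norm_of_nonneg (inv_nonneg.2 hr.le), inv_mul_cancel_left₀ hr.ne']
  have : Inhabited E := ⟨0⟩
  intro y
  obtain ⟨x, hx⟩ :=
    (hi.affineIsometryOfStrictConvexSpace.toAffineIsometryEquiv rfl).surjective (r⁻¹ • y)
  exact ⟨x, smul_right_injective E (inv_ne_zero hr.ne') hx⟩

variable [MeasurableSpace X] [BorelSpace X] [MeasurableSpace Y] [BorelSpace Y] {d : ℝ}

theorem hausdorffMeasure_image_of_dist_eq_mul (hr : 0 < r)
    (hf : ∀ x y, dist (f x) (f y) = r * dist x y) (hd : 0 ≤ d) (s : Set X) :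
    μH[d] (f '' s) = ENNReal.ofReal r ^ d * μH[d] s := by
  have hr₀ : ENNReal.ofReal r ≠ 0 := (ENNReal.ofReal_pos.2 hr).ne'
  refine le_antisymm ((lipschitzWith_of_dist_eq_mul hr hf).hausdorffMeasure_image_le hd s) ?_
  have h := (antilipschitzWith_of_dist_eq_mul hr hf).le_hausdorffMeasure_image hd s
  change μH[d] s ≤ ENNReal.ofReal r⁻¹ ^ d * _ at h
  rwa [ENNReal.ofReal_inv_of_pos hr, ENNReal.inv_rpow, ← ENNReal.div_eq_inv_mul,
    ENNReal.le_div_iff_mul_le (Or.inl <| (ENNReal.rpow_pos hr₀.bot_lt ENNReal.ofReal_ne_top).ne')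
      (Or.inl <| ENNReal.rpow_ne_top_of_nonneg hd ENNReal.ofReal_ne_top), mul_comm] at h

-- The overlaps of the pieces are null because the masses of the pieces add up to the total mass.
theorem sum_smul_map_hausdorffMeasure {ι : Type*} [Fintype ι] {g : ι → X → X} {r : ι → ℝ}
    (hr : ∀ i, 0 < r i) (hg : ∀ i x y, dist (g i x) (g i y) = r i * dist x y)
    (hcover : ⋃ i, Set.range (g i) = Set.univ) (hd : 0 ≤ d)
    (hsum : ∑ i, ENNReal.ofReal (r i) ^ d = 1) (hfin : μH[d] (Set.univ : Set X) ≠ ⊤) :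
    ∑ i, ENNReal.ofReal (r i) ^ d • (μH[d] : Measure X).map (g i) = μH[d] := by
  have hmeas : ∀ i, Measurable (g i) := fun i =>
    (lipschitzWith_of_dist_eq_mul (hr i) (hg i)).continuous.measurable
  have : IsFiniteMeasure (μH[d] : Measure X) := ⟨hfin.lt_top⟩
  have hle : μH[d] ≤ ∑ i, ENNReal.ofReal (r i) ^ d • (μH[d] : Measure X).map (g i) := by
    refine Measure.le_iff.2 fun s hs => ?_
    calc μH[d] s = μH[d] (⋃ i, s ∩ Set.range (g i)) := by
          rw [← Set.inter_iUnion, hcover, Set.inter_univ]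
      _ ≤ ∑ i, μH[d] (s ∩ Set.range (g i)) := measure_iUnion_fintype_le _ _
      _ = _ := by
          simp only [Measure.finsetSum_apply, Measure.smul_apply, smul_eq_mul,
            Measure.map_apply (hmeas _) hs, ← Set.image_preimage_eq_inter_range,
            hausdorffMeasure_image_of_dist_eq_mul (hr _) (hg _) hd]
  refine (Measure.eq_of_le_of_measure_univ_eq hle ?_).symm
  simp only [Measure.finsetSum_apply, Measure.smul_apply, smul_eq_mul,
    Measure.map_apply (hmeas _) MeasurableSet.univ, Set.preimage_univ, ← Finset.sum_mul, hsum,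
    one_mul]

theorem hausdorffMeasure_pos_of_le_ediam_rpow {ν : Measure X} {c : ℝ≥0∞} (hc : c ≠ ⊤)
    (hν : ∀ s : Set X, IsClosed s → Metric.ediam s ≤ 1 → ν s ≤ c * Metric.ediam s ^ d)
    {s : Set X} (hs : ν s ≠ 0) : 0 < μH[d] s := by
  have hle : c⁻¹ • ν ≤ μH[d] := by
    refine Measure.le_hausdorffMeasure d _ 1 one_pos fun t ht => ?_
    rw [← Metric.ediam_closure] at ht ⊢
    rw [Measure.smul_apply, smul_eq_mul, ← ENNReal.div_eq_inv_mul]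
    refine ENNReal.div_le_of_le_mul' ?_
    exact (measure_mono subset_closure).trans (hν _ isClosed_closure ht)
  exact (ENNReal.mul_pos (ENNReal.inv_ne_zero.2 hc) hs).trans_le (hle s)

end Similarity

theorem le_mul_rpow_of_forall_pow {q x a C : ℝ≥0∞} (hq₀ : q ≠ 0) (hq₁ : q < 1) (hC : C ≠ ⊤)
    {d : ℝ} (hd : 0 < d) (hx : x ≤ 1) (h : ∀ n : ℕ, x ≤ q ^ n → a ≤ C * (q ^ d) ^ n) :
    a ≤ C * (q ^ d)⁻¹ * x ^ d := by
  have hpow : ∀ n : ℕ, (q ^ d) ^ n = (q ^ n) ^ d := fun n => by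
    rw [← ENNReal.rpow_natCast, ← ENNReal.rpow_mul, mul_comm, ENNReal.rpow_mul,
      ENNReal.rpow_natCast]
  rcases eq_or_ne x 0 with rfl | hx₀
  · have hlim : Tendsto (fun n : ℕ => C * (q ^ d) ^ n) atTop (𝓝 (C * 0)) :=
      ENNReal.Tendsto.const_mul (ENNReal.tendsto_pow_atTop_nhds_zero_of_lt_one
        (ENNReal.rpow_lt_one hq₁ hd)) (Or.inr hC)
    rw [mul_zero] at hlim
    exact (ge_of_tendsto' hlim fun n => h n zero_le).trans zero_le
  · have hex : ∃ n : ℕ, q ^ n < x :=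
      ((ENNReal.tendsto_pow_atTop_nhds_zero_of_lt_one hq₁).eventually_lt_const
        (pos_iff_ne_zero.2 hx₀)).exists
    obtain ⟨m, hm⟩ := Nat.exists_eq_succ_of_ne_zero (n := Nat.find hex) fun h₀ =>
      (Nat.find_spec hex).not_ge (by rwa [h₀, pow_zero])
    have hlt : q ^ (m + 1) < x := by simpa only [hm] using Nat.find_spec hex
    have hle : x ≤ q ^ m := not_lt.1 (Nat.find_min hex (by lia))
    have hqd₀ : q ^ d ≠ 0 := (ENNReal.rpow_pos hq₀.bot_lt hq₁.ne_top).ne'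
    calc a ≤ C * (q ^ d) ^ m := h m hle
      _ = C * (q ^ d)⁻¹ * (q ^ (m + 1)) ^ d := by
        rw [← hpow, pow_succ', mul_assoc, ENNReal.inv_mul_cancel_left hqd₀
          (ENNReal.rpow_ne_top_of_nonneg hd.le hq₁.ne_top)]
      _ ≤ C * (q ^ d)⁻¹ * x ^ d := by gcongr

theorem exists_card_le_of_separated {X ι : Type*} [PseudoMetricSpace X] {s : Set X}
    (hs : TotallyBounded s) {r : ℝ} (hr : 0 < r) :
    ∃ M : ℕ, ∀ (A : Finset ι) (u : ι → X), (∀ i ∈ A, u i ∈ s) →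
      (∀ i ∈ A, ∀ j ∈ A, i ≠ j → r ≤ dist (u i) (u j)) → A.card ≤ M := by
  obtain ⟨t, ht, hst⟩ := Metric.totallyBounded_iff.1 hs (r / 2) (half_pos hr)
  refine ⟨ht.toFinset.card, fun A u hu hsep => ?_⟩
  refine Finset.card_le_card_of_forall_subsingleton (fun i c => dist (u i) c < r / 2)
    (fun i hi => by simpa using hst (hu i hi)) ?_
  rintro c - i ⟨hi, hic⟩ j ⟨hj, hjc⟩
  by_contra hne
  linarith [dist_triangle_right (u i) (u j) c, hsep i hi j hj hne]

theorem exists_uniform_bernoulli (α : Type*) [Fintype α] [Nonempty α] [MeasurableSpace α]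
    [MeasurableSingletonClass α] :
    ∃ P : Measure (ℕ → α), IsProbabilityMeasure P ∧
      ∀ (n : ℕ) (τ : Fin n → α),
        P {ω | ∀ i : Fin n, ω i = τ i} = ((Fintype.card α : ℝ≥0∞) ^ n)⁻¹ := by
  refine ⟨Measure.infinitePi fun _ => (PMF.uniformOfFintype α).toMeasure, inferInstance,
    fun n τ => ?_⟩
  let t : ℕ → Set α := fun i => {a | ∀ h : i < n, a = τ ⟨i, h⟩}
  have hset : {ω : ℕ → α | ∀ i : Fin n, ω i = τ i} = Set.pi (Finset.range n) t := by
    ext ω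
    simp [t, Fin.forall_iff, Set.mem_pi]
  have ht : ∀ i ∈ Finset.range n,
      (PMF.uniformOfFintype α).toMeasure (t i) = (Fintype.card α : ℝ≥0∞)⁻¹ := by
    intro i hi
    have hti : t i = {τ ⟨i, Finset.mem_range.1 hi⟩} := by
      ext a
      simp [t, Finset.mem_range.1 hi]
    rw [hti, PMF.toMeasure_apply_singleton _ _ (measurableSet_singleton _),
      PMF.uniformOfFintype_apply]
  rw [hset, Measure.infinitePi_pi _ fun i _ => (Set.toFinite _).measurableSet,
    Finset.prod_congr rfl ht, Finset.prod_const, Finset.card_range, ENNReal.inv_pow]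

theorem abs_sub_integral_le {α : Type*} [MeasurableSpace α] {μ : Measure α}
    [IsProbabilityMeasure μ] {f : α → ℝ} (hf : Integrable f μ) {c ε : ℝ}
    (h : ∀ x, |c - f x| ≤ ε) : |c - ∫ x, f x ∂μ| ≤ ε := by
  have hle := norm_integral_le_of_norm_le_const (μ := μ) (f := fun x => c - f x)
    (Eventually.of_forall h)
  rwa [integral_sub (integrable_const c) hf, integral_const, probReal_univ, one_smul,
    mul_one] at hle

namespace SelfSimilarFractal

theorem nonempty_alphabet {N k : ℕ} (F : SelfSimilarFractal N k) : Nonempty (Fin k) := by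
  obtain ⟨x, hx⟩ := F.nonempty_K
  rw [F.K_eq] at hx
  exact (Set.mem_iUnion.1 hx).nonempty

variable {N k : ℕ} (F : SelfSimilarFractal N k)

/-- All the similarities of `F` have the same ratio `lam`. -/
def IsHomogeneous (lam : ℝ) : Prop := ∀ i, F.ratio i = lam

/-- Moran's open set condition, which limits the overlaps of the pieces of `F`. -/
def OpenSetCondition : Prop :=
  ∃ U : Set (EuclideanSpace ℝ (Fin N)),
    IsOpen U ∧ Bornology.IsBounded U ∧ U.Nonempty ∧ (∀ i, F.w i '' U ⊆ U) ∧
      ∀ i j, i ≠ j → Disjoint (F.w i '' U) (F.w j '' U)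

theorem one_lt_card_of_nontrivial_V₀ (hV : F.V₀.Nontrivial) : 1 < k := by
  obtain ⟨p, ⟨i, hi, -⟩, q, ⟨j, hj, -⟩, hpq⟩ := hV
  have hij : i ≠ j := by
    rintro rfl
    exact hpq (F.fixedPoint_unique hi hj)
  simpa using Fintype.one_lt_card_iff.2 ⟨i, j, hij⟩

theorem dist_wWord (σ : List (Fin k)) (x y : EuclideanSpace ℝ (Fin N)) :
    dist (F.wWord σ x) (F.wWord σ y) = F.ratioWord σ * dist x y := by
  induction σ with
  | nil => simp [wWord, ratioWord]
  | cons i σ ih =>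
    simp only [wWord, Function.comp_apply, F.dist_w, ih, ratioWord, List.map_cons, List.prod_cons]
    ring

theorem ratioWord_pos (σ : List (Fin k)) : 0 < F.ratioWord σ :=
  List.prod_pos fun _ h => by
    obtain ⟨i, -, rfl⟩ := List.mem_map.1 h
    exact F.ratio_pos i

theorem wWord_append (σ τ : List (Fin k)) : F.wWord (σ ++ τ) = F.wWord σ ∘ F.wWord τ := by
  induction σ with
  | nil => rfl
  | cons i σ ih => simp only [List.cons_append, wWord, ih, Function.comp_assoc]

theorem isCompact_wWord_image_K (σ : List (Fin k)) : IsCompact (F.wWord σ '' F.K) :=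
  F.isCompact_K.image
    (lipschitzWith_of_dist_eq_mul (F.ratioWord_pos σ) (F.dist_wWord σ)).continuous

theorem wWord_image_subset {U : Set (EuclideanSpace ℝ (Fin N))} (hU : ∀ i, F.w i '' U ⊆ U)
    (σ : List (Fin k)) : F.wWord σ '' U ⊆ U := by
  induction σ with
  | nil => simp [wWord]
  | cons i σ ih =>
    rw [wWord, Set.image_comp]
    exact (Set.image_mono ih).trans (hU i)

theorem disjoint_wWord_image {U : Set (EuclideanSpace ℝ (Fin N))} (hU : ∀ i, F.w i '' U ⊆ U)
    (hdisj : ∀ i j, i ≠ j → Disjoint (F.w i '' U) (F.w j '' U)) {σ τ : List (Fin k)}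
    (hlen : σ.length = τ.length) (hne : σ ≠ τ) :
    Disjoint (F.wWord σ '' U) (F.wWord τ '' U) := by
  induction σ generalizing τ with
  | nil => exact absurd (List.length_eq_zero_iff.1 hlen.symm).symm hne
  | cons i σ ih =>
    cases τ with
    | nil => simp at hlen
    | cons j τ =>
      simp only [wWord, Set.image_comp]
      rcases eq_or_ne i j with rfl | hij
      · refine (Set.disjoint_image_iff
          (injective_of_dist_eq_mul (F.ratio_pos i) (F.dist_w i))).2 (ih (by simpa using hlen) ?_)
        rintro rfl
        exact hne rfl
      · exact (hdisj i j hij).mono (Set.image_mono (F.wWord_image_subset hU σ))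
          (Set.image_mono (F.wWord_image_subset hU τ))

theorem iUnion_wWord_image_K (n : ℕ) :
    ⋃ τ : Fin n → Fin k, F.wWord (List.ofFn τ) '' F.K = F.K := by
  induction n with
  | zero => simp [wWord, Set.iUnion_const]
  | succ n ih =>
    have hcons : ∀ (i : Fin k) (τ : Fin n → Fin k),
        F.wWord (List.ofFn (Fin.cons i τ : Fin (n + 1) → Fin k)) '' F.K =
          F.w i '' (F.wWord (List.ofFn τ) '' F.K) := fun i τ => by
      rw [List.ofFn_succ, ← Set.image_comp]
      simp [wWord]
    conv_rhs => rw [F.K_eq, ← ih]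
    simp only [Set.image_iUnion, Set.ext_iff, Set.mem_iUnion, Fin.exists_fin_succ_pi, hcons,
      implies_true]

/-- The contraction `w_σ`, as a self-map of the fractal. -/
def cellMap (σ : List (Fin k)) (x : F.K) : F.K := ⟨F.wWord σ x, F.wWord_mem σ x.2⟩

theorem iUnion_range_cellMap (n : ℕ) :
    ⋃ τ : Fin n → Fin k, Set.range (F.cellMap (List.ofFn τ)) = Set.univ := by
  refine Set.eq_univ_of_forall fun ⟨x, hx⟩ => ?_
  rw [← F.iUnion_wWord_image_K n] at hx
  obtain ⟨τ, y, hy, rfl⟩ := Set.mem_iUnion.1 hx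
  exact Set.mem_iUnion.2 ⟨τ, ⟨y, hy⟩, rfl⟩

theorem exists_coding :
    ∃ π : (ℕ → Fin k) → EuclideanSpace ℝ (Fin N),
      ∀ ω (n : ℕ), π ω ∈ F.wWord (List.ofFn fun i : Fin n => ω i) '' F.K := by
  have hanti : ∀ (ω : ℕ → Fin k) (n : ℕ), F.wWord (List.ofFn fun i : Fin (n + 1) => ω i) '' F.K ⊆
      F.wWord (List.ofFn fun i : Fin n => ω i) '' F.K := fun ω n => by
    rw [List.ofFn_succ_last, F.wWord_append, Set.image_comp]
    exact Set.image_mono (Set.image_subset_iff.2 fun x hx => F.wWord_mem _ hx)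
  have hinter : ∀ ω : ℕ → Fin k,
      (⋂ n : ℕ, F.wWord (List.ofFn fun i : Fin n => ω i) '' F.K).Nonempty := fun ω =>
    IsCompact.nonempty_iInter_of_sequence_nonempty_isCompact_isClosed _ (hanti ω)
      (fun _ => F.nonempty_K.image _) (F.isCompact_wWord_image_K _)
      fun _ => (F.isCompact_wWord_image_K _).isClosed
  choose π hπ using hinter
  exact ⟨π, fun ω n => Set.mem_iInter.1 (hπ ω) n⟩

theorem normalizedHausdorff_eq {d : ℝ} (hd₀ : 0 ≤ d) :
    F.normalizedHausdorff d = (μH[d] F.K)⁻¹ • (μH[d] : Measure F.K) := by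
  rw [normalizedHausdorff]
  congr 1
  refine Measure.ext fun s _ => ?_
  rw [comap_subtype_coe_apply F.isCompact_K.isClosed.measurableSet,
    isometry_subtype_coe.hausdorffMeasure_image (Or.inl hd₀)]

theorem hausdorffMeasure_univ_K {d : ℝ} (hd₀ : 0 ≤ d) :
    μH[d] (Set.univ : Set F.K) = μH[d] F.K := by
  rw [← isometry_subtype_coe.hausdorffMeasure_image (Or.inl hd₀), Set.image_univ,
    Subtype.range_coe]

variable {F} {lam : ℝ}

namespace IsHomogeneous

theorem lam_pos (hF : F.IsHomogeneous lam) : 0 < lam := by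
  obtain ⟨i⟩ := F.nonempty_alphabet
  exact hF i ▸ F.ratio_pos i

theorem lam_lt_one (hF : F.IsHomogeneous lam) : lam < 1 := by
  obtain ⟨i⟩ := F.nonempty_alphabet
  exact hF i ▸ F.ratio_lt_one i

theorem ratioWord_eq (hF : F.IsHomogeneous lam) (σ : List (Fin k)) :
    F.ratioWord σ = lam ^ σ.length := by
  rw [ratioWord, List.map_congr_left (g := fun _ => lam) fun i _ => hF i, List.map_const',
    List.prod_replicate]

theorem dist_wWord_ofFn (hF : F.IsHomogeneous lam) {n : ℕ} (τ : Fin n → Fin k)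
    (x y : EuclideanSpace ℝ (Fin N)) :
    dist (F.wWord (List.ofFn τ) x) (F.wWord (List.ofFn τ) y) = lam ^ n * dist x y := by
  rw [F.dist_wWord, hF.ratioWord_eq, List.length_ofFn]

theorem tendsto_pow_mul (hF : F.IsHomogeneous lam) (C : ℝ) :
    Tendsto (fun n : ℕ => lam ^ n * C) atTop (𝓝 0) := by
  simpa using (tendsto_pow_atTop_nhds_zero_of_lt_one hF.lam_pos.le hF.lam_lt_one).mul_const C

theorem exists_dist_wWord_ge (hF : F.IsHomogeneous lam) (hU : F.OpenSetCondition) :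
    ∃ (u : EuclideanSpace ℝ (Fin N)) (r : ℝ), 0 < r ∧ ∀ (n : ℕ) (σ τ : Fin n → Fin k), σ ≠ τ →
      lam ^ n * r ≤ dist (F.wWord (List.ofFn σ) u) (F.wWord (List.ofFn τ) u) := by
  obtain ⟨U, hUo, -, ⟨u, hu⟩, hUsub, hUdisj⟩ := hU
  obtain ⟨r, hr, hball⟩ := Metric.isOpen_iff.1 hUo u hu
  refine ⟨u, r, hr, fun n σ τ hne => ?_⟩
  by_contra! h
  obtain ⟨v, hv⟩ := surjective_of_dist_eq_mul (F.ratioWord_pos (List.ofFn σ))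
    (F.dist_wWord (List.ofFn σ)) (F.wWord (List.ofFn τ) u)
  rw [← hv, hF.dist_wWord_ofFn, mul_lt_mul_iff_right₀ (pow_pos hF.lam_pos n), dist_comm] at h
  exact Set.disjoint_left.1 (F.disjoint_wWord_image hUsub hUdisj (by simp)
    fun h => hne (List.ofFn_injective h)) ⟨v, hball h, hv⟩ ⟨u, hu, rfl⟩

-- Rescaling the cells by `λ ^ (-n)` turns them into separated points of a fixed ball.
theorem exists_card_cells_le (hF : F.IsHomogeneous lam) (hU : F.OpenSetCondition) :
    ∃ M : ℕ, ∀ (n : ℕ) (s : Set (EuclideanSpace ℝ (Fin N))),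
      Metric.ediam s ≤ ENNReal.ofReal (lam ^ n) → ∀ A : Finset (Fin n → Fin k),
        (∀ τ ∈ A, (F.wWord (List.ofFn τ) '' F.K ∩ s).Nonempty) → A.card ≤ M := by
  obtain ⟨u, r, hr, hsep⟩ := hF.exists_dist_wWord_ge hU
  obtain ⟨R, hR⟩ := F.isCompact_K.isBounded.subset_closedBall u
  have hbdd := (isCompact_closedBall (0 : EuclideanSpace ℝ (Fin N)) (R + 1)).totallyBounded
  obtain ⟨M, hM⟩ := exists_card_le_of_separated (ι := List (Fin k)) hbdd hr
  refine ⟨M, fun n s hs A hA => ?_⟩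
  rcases A.eq_empty_or_nonempty with rfl | ⟨τ₀, hτ₀⟩
  · simp
  obtain ⟨z, -, hz⟩ := hA τ₀ hτ₀
  have hl : 0 < lam ^ n := pow_pos hF.lam_pos n
  have hnorm : ‖(lam ^ n)⁻¹‖ = (lam ^ n)⁻¹ := Real.norm_of_nonneg (inv_nonneg.2 hl.le)
  have hdist : ∀ x ∈ s, dist x z ≤ lam ^ n := fun x hx => by
    have h := (Metric.edist_le_ediam_of_mem hx hz).trans hs
    rwa [edist_dist, ENNReal.ofReal_le_ofReal_iff hl.le] at h
  rw [← Finset.card_map ⟨List.ofFn, List.ofFn_injective⟩]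
  refine hM _ (fun σ => (lam ^ n)⁻¹ • (F.wWord σ u - z)) ?_ ?_
  · simp only [Finset.forall_mem_map, Function.Embedding.coeFn_mk]
    intro τ hτ
    obtain ⟨_, ⟨y, hy, rfl⟩, hys⟩ := hA τ hτ
    rw [mem_closedBall_zero_iff, norm_smul, hnorm, ← dist_eq_norm, inv_mul_le_iff₀ hl, mul_add,
      mul_one]
    refine (dist_triangle _ (F.wWord (List.ofFn τ) y) _).trans (add_le_add ?_ (hdist _ hys))
    rw [hF.dist_wWord_ofFn, dist_comm]
    exact mul_le_mul_of_nonneg_left (hR hy) hl.le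
  · simp only [Finset.forall_mem_map, Function.Embedding.coeFn_mk]
    intro σ _ τ _ hne
    rw [dist_smul₀, dist_sub_right, hnorm, le_inv_mul_iff₀ hl]
    exact hsep n σ τ fun h => hne (by rw [h])

theorem measurable_of_forall_mem_wWord_image (hF : F.IsHomogeneous lam)
    {π : (ℕ → Fin k) → EuclideanSpace ℝ (Fin N)}
    (hπ : ∀ ω (n : ℕ), π ω ∈ F.wWord (List.ofFn fun i : Fin n => ω i) '' F.K) : Measurable π := by
  obtain ⟨x₀, hx₀⟩ := F.nonempty_K
  obtain ⟨C, hC⟩ := Metric.isBounded_iff.1 F.isCompact_K.isBounded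
  let u : ℕ → (ℕ → Fin k) → EuclideanSpace ℝ (Fin N) := fun n ω =>
    F.wWord (List.ofFn fun i : Fin n => ω i) x₀
  have hu : ∀ n, Measurable (u n) := fun n => by
    have hprefix : Measurable fun (ω : ℕ → Fin k) (i : Fin n) => ω i :=
      measurable_pi_lambda _ fun i => measurable_pi_apply _
    exact (measurable_of_finite fun τ : Fin n → Fin k => F.wWord (List.ofFn τ) x₀).comp hprefix
  refine measurable_of_tendsto_metrizable hu (tendsto_pi_nhds.2 fun ω => ?_)
  refine tendsto_iff_dist_tendsto_zero.2
    (squeeze_zero (fun _ => dist_nonneg) (fun n => ?_) (hF.tendsto_pow_mul C))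
  obtain ⟨x, hx, hxω⟩ := hπ ω n
  rw [← hxω, hF.dist_wWord_ofFn]
  exact mul_le_mul_of_nonneg_left (hC hx₀ hx) (pow_pos hF.lam_pos n).le

theorem exists_mass_distribution (hF : F.IsHomogeneous lam) (hU : F.OpenSetCondition) :
    ∃ (ν : Measure (EuclideanSpace ℝ (Fin N))) (M : ℕ), ν F.K = 1 ∧
      ∀ (n : ℕ) (s : Set (EuclideanSpace ℝ (Fin N))), IsClosed s →
        Metric.ediam s ≤ ENNReal.ofReal (lam ^ n) → ν s ≤ M * ((k : ℝ≥0∞)⁻¹) ^ n := by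
  classical
  have := F.nonempty_alphabet
  obtain ⟨P, hP, hcyl⟩ := exists_uniform_bernoulli (Fin k)
  obtain ⟨π, hπ⟩ := F.exists_coding
  have hπm := hF.measurable_of_forall_mem_wWord_image hπ
  obtain ⟨M, hM⟩ := hF.exists_card_cells_le hU
  refine ⟨P.map π, M, ?_, fun n s hsc hs => ?_⟩
  · have hK : π ⁻¹' F.K = Set.univ := Set.eq_univ_of_forall fun ω => by
      simpa [wWord] using hπ ω 0
    rw [Measure.map_apply hπm F.isCompact_K.isClosed.measurableSet, hK, measure_univ]
  · let A : Finset (Fin n → Fin k) := {τ | (F.wWord (List.ofFn τ) '' F.K ∩ s).Nonempty}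
    have hcover : π ⁻¹' s ⊆ ⋃ τ ∈ A, {ω | ∀ i : Fin n, ω i = τ i} := fun ω hω =>
      Set.mem_iUnion₂.2 ⟨fun i => ω i, Finset.mem_filter.2 ⟨Finset.mem_univ _,
        π ω, hπ ω n, hω⟩, fun i => rfl⟩
    calc P.map π s = P (π ⁻¹' s) := Measure.map_apply hπm hsc.measurableSet
      _ ≤ ∑ τ ∈ A, P {ω | ∀ i : Fin n, ω i = τ i} :=
        (measure_mono hcover).trans (measure_biUnion_finset_le _ _)
      _ = A.card * ((k : ℝ≥0∞)⁻¹) ^ n := by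
        simp only [hcyl, Fintype.card_fin, Finset.sum_const, nsmul_eq_mul, ENNReal.inv_pow]
      _ ≤ M * ((k : ℝ≥0∞)⁻¹) ^ n := by
        gcongr
        exact hM n s hs A fun τ hτ => (Finset.mem_filter.1 hτ).2

variable {d : ℝ}

theorem ofReal_rpow_eq_inv (hF : F.IsHomogeneous lam) (hd : (k : ℝ) * lam ^ d = 1) :
    ENNReal.ofReal lam ^ d = (k : ℝ≥0∞)⁻¹ := by
  have hk : (0 : ℝ) < k := Nat.cast_pos.2 (Fin.pos_iff_nonempty.2 F.nonempty_alphabet)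
  rw [ENNReal.ofReal_rpow_of_pos hF.lam_pos, eq_inv_of_mul_eq_one_right hd,
    ENNReal.ofReal_inv_of_pos hk, ENNReal.ofReal_natCast]

theorem ofReal_pow_rpow_eq_inv (hF : F.IsHomogeneous lam) (hd : (k : ℝ) * lam ^ d = 1) (n : ℕ) :
    ENNReal.ofReal (lam ^ n) ^ d = ((k : ℝ≥0∞) ^ n)⁻¹ := by
  rw [ENNReal.ofReal_pow hF.lam_pos.le, ← ENNReal.rpow_natCast, ← ENNReal.rpow_mul, mul_comm,
    ENNReal.rpow_mul, hF.ofReal_rpow_eq_inv hd, ENNReal.rpow_natCast, ENNReal.inv_pow]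

theorem sum_ofReal_pow_rpow (hF : F.IsHomogeneous lam) (hd : (k : ℝ) * lam ^ d = 1) (n : ℕ) :
    ∑ _τ : Fin n → Fin k, ENNReal.ofReal (lam ^ n) ^ d = 1 := by
  have hk : (k : ℝ≥0∞) ≠ 0 :=
    Nat.cast_ne_zero.2 (Fin.pos_iff_nonempty.2 F.nonempty_alphabet).ne'
  rw [hF.ofReal_pow_rpow_eq_inv hd, Finset.sum_const, Finset.card_univ, Fintype.card_fun,
    Fintype.card_fin, Fintype.card_fin, nsmul_eq_mul, Nat.cast_pow,
    ENNReal.mul_inv_cancel (pow_ne_zero n hk) (ENNReal.pow_ne_top (ENNReal.natCast_ne_top k))]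

theorem hausdorffMeasure_K_pos (hF : F.IsHomogeneous lam) (hU : F.OpenSetCondition) (hd₀ : 0 < d)
    (hd : (k : ℝ) * lam ^ d = 1) : 0 < μH[d] F.K := by
  obtain ⟨ν, M, hνK, hν⟩ := hF.exists_mass_distribution hU
  have hM : (M : ℝ≥0∞) ≠ ⊤ := ENNReal.natCast_ne_top M
  have hq₀ : ENNReal.ofReal lam ≠ 0 := (ENNReal.ofReal_pos.2 hF.lam_pos).ne'
  have hqd : (ENNReal.ofReal lam ^ d)⁻¹ = k := by rw [hF.ofReal_rpow_eq_inv hd, inv_inv]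
  refine hausdorffMeasure_pos_of_le_ediam_rpow (c := M * k)
    (ENNReal.mul_ne_top hM (ENNReal.natCast_ne_top k)) (fun s hsc hs => ?_)
    (hνK.trans_ne one_ne_zero)
  rw [← hqd]
  refine le_mul_rpow_of_forall_pow hq₀ (ENNReal.ofReal_lt_one.2 hF.lam_lt_one) hM hd₀ hs
    fun n hn => ?_
  rw [hF.ofReal_rpow_eq_inv hd]
  exact hν n s hsc (by rwa [ENNReal.ofReal_pow hF.lam_pos.le])

theorem hausdorffMeasure_K_lt_top (hF : F.IsHomogeneous lam) (hd₀ : 0 < d)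
    (hd : (k : ℝ) * lam ^ d = 1) : μH[d] F.K < ⊤ := by
  have hdiam : Metric.ediam F.K ≠ ⊤ := F.isCompact_K.isBounded.ediam_ne_top
  have hcell : ∀ (n : ℕ) (τ : Fin n → Fin k), Metric.ediam (F.wWord (List.ofFn τ) '' F.K) ≤
      ENNReal.ofReal (lam ^ n) * Metric.ediam F.K := fun n τ =>
    (lipschitzWith_of_dist_eq_mul (pow_pos hF.lam_pos n) (hF.dist_wWord_ofFn τ)).ediam_image_le F.K
  have hmesh : Tendsto (fun n : ℕ => ENNReal.ofReal (lam ^ n) * Metric.ediam F.K) atTop (𝓝 0) := by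
    have h := ENNReal.tendsto_ofReal
      (tendsto_pow_atTop_nhds_zero_of_lt_one hF.lam_pos.le hF.lam_lt_one)
    simpa using ENNReal.Tendsto.mul_const h (Or.inr hdiam)
  have hsum : ∀ n : ℕ, ∑ τ : Fin n → Fin k, Metric.ediam (F.wWord (List.ofFn τ) '' F.K) ^ d ≤
      Metric.ediam F.K ^ d := fun n => by
    refine (Finset.sum_le_sum fun τ _ => ENNReal.rpow_le_rpow (hcell n τ) hd₀.le).trans_eq ?_
    simp_rw [ENNReal.mul_rpow_of_nonneg _ _ hd₀.le, ← Finset.sum_mul, hF.sum_ofReal_pow_rpow hd,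
      one_mul]
  calc μH[d] F.K ≤ liminf (fun n : ℕ => ∑ τ : Fin n → Fin k,
          Metric.ediam (F.wWord (List.ofFn τ) '' F.K) ^ d) atTop :=
        Measure.hausdorffMeasure_le_liminf_sum d F.K _ hmesh _ (Eventually.of_forall hcell)
          (Eventually.of_forall fun n => (F.iUnion_wWord_image_K n).superset)
    _ ≤ liminf (fun _ : ℕ => Metric.ediam F.K ^ d) atTop :=
        liminf_le_liminf (Eventually.of_forall hsum)
    _ = Metric.ediam F.K ^ d := liminf_const _
    _ < ⊤ := ENNReal.rpow_lt_top_of_nonneg hd₀.le hdiam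

theorem isProbabilityMeasure_normalizedHausdorff (hF : F.IsHomogeneous lam)
    (hU : F.OpenSetCondition) (hd₀ : 0 < d) (hd : (k : ℝ) * lam ^ d = 1) :
    IsProbabilityMeasure (F.normalizedHausdorff d) := by
  constructor
  rw [F.normalizedHausdorff_eq hd₀.le, Measure.smul_apply, F.hausdorffMeasure_univ_K hd₀.le,
    smul_eq_mul, ENNReal.inv_mul_cancel (hF.hausdorffMeasure_K_pos hU hd₀ hd).ne'
      (hF.hausdorffMeasure_K_lt_top hd₀ hd).ne]

theorem dist_cellMap (hF : F.IsHomogeneous lam) {n : ℕ} (τ : Fin n → Fin k) (x y : F.K) :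
    dist (F.cellMap (List.ofFn τ) x) (F.cellMap (List.ofFn τ) y) = lam ^ n * dist x y :=
  hF.dist_wWord_ofFn τ x y

theorem continuous_cellMap (hF : F.IsHomogeneous lam) {n : ℕ} (τ : Fin n → Fin k) :
    Continuous (F.cellMap (List.ofFn τ)) :=
  (lipschitzWith_of_dist_eq_mul (pow_pos hF.lam_pos n) (hF.dist_cellMap τ)).continuous

theorem sum_smul_map_normalizedHausdorff (hF : F.IsHomogeneous lam) (hd₀ : 0 < d)
    (hd : (k : ℝ) * lam ^ d = 1) (n : ℕ) :
    ∑ τ : Fin n → Fin k, ((k : ℝ≥0∞) ^ n)⁻¹ •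
      (F.normalizedHausdorff d).map (F.cellMap (List.ofFn τ)) = F.normalizedHausdorff d := by
  have h := sum_smul_map_hausdorffMeasure (fun _ => pow_pos hF.lam_pos n) hF.dist_cellMap
    (F.iUnion_range_cellMap n) hd₀.le (hF.sum_ofReal_pow_rpow hd n)
    ((F.hausdorffMeasure_univ_K hd₀.le).trans_ne (hF.hausdorffMeasure_K_lt_top hd₀ hd).ne)
  rw [F.normalizedHausdorff_eq hd₀.le]
  simp only [Measure.map_smul]
  nth_rw 2 [← h]
  rw [Finset.smul_sum]
  exact Finset.sum_congr rfl fun τ _ => by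
    rw [hF.ofReal_pow_rpow_eq_inv hd, smul_comm]

theorem sum_integral_cellMap (hF : F.IsHomogeneous lam) (hU : F.OpenSetCondition) (hd₀ : 0 < d)
    (hd : (k : ℝ) * lam ^ d = 1) (f : C(F.K, ℝ)) (n : ℕ) :
    ((k : ℝ) ^ n)⁻¹ * ∑ τ : Fin n → Fin k,
      ∫ x, f (F.cellMap (List.ofFn τ) x) ∂F.normalizedHausdorff d =
        ∫ x, f x ∂F.normalizedHausdorff d := by
  have := isCompact_iff_compactSpace.1 F.isCompact_K
  have := hF.isProbabilityMeasure_normalizedHausdorff hU hd₀ hd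
  have hself := hF.sum_smul_map_normalizedHausdorff hd₀ hd n
  have hint : Integrable f (F.normalizedHausdorff d) :=
    f.continuous.integrable_of_hasCompactSupport (.of_compactSpace f)
  have hcells := integrable_finsetSum_measure.1 (hself.symm ▸ hint)
  conv_rhs => rw [← hself, integral_finsetSum_measure hcells]
  rw [Finset.mul_sum]
  refine Finset.sum_congr rfl fun τ _ => ?_
  rw [integral_smul_measure, integral_map (hF.continuous_cellMap τ).aemeasurable
    f.continuous.aestronglyMeasurable]
  simp

theorem tendsto_average (hF : F.IsHomogeneous lam) (hU : F.OpenSetCondition) (hd₀ : 0 < d)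
    (hd : (k : ℝ) * lam ^ d = 1) (f : C(F.K, ℝ)) (p : F.K) :
    Tendsto (fun n : ℕ => ((k : ℝ) ^ n)⁻¹ * ∑ τ : Fin n → Fin k, f (F.cellMap (List.ofFn τ) p))
      atTop (𝓝 (∫ x, f x ∂F.normalizedHausdorff d)) := by
  have := isCompact_iff_compactSpace.1 F.isCompact_K
  have := hF.isProbabilityMeasure_normalizedHausdorff hU hd₀ hd
  have hk : (0 : ℝ) < k := Nat.cast_pos.2 (Fin.pos_iff_nonempty.2 F.nonempty_alphabet)
  obtain ⟨C, hC⟩ := Metric.isBounded_iff.1 F.isCompact_K.isBounded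
  rw [Metric.tendsto_nhds]
  intro ε hε
  obtain ⟨δ, hδ, hf⟩ := Metric.uniformContinuous_iff.1
    (CompactSpace.uniformContinuous_of_continuous f.continuous) (ε / 2) (half_pos hε)
  filter_upwards [(hF.tendsto_pow_mul C).eventually_lt_const hδ] with n hn
  have hcell : ∀ τ : Fin n → Fin k, |f (F.cellMap (List.ofFn τ) p) -
      ∫ x, f (F.cellMap (List.ofFn τ) x) ∂F.normalizedHausdorff d| ≤ ε / 2 := fun τ => by
    have hint : Integrable (fun x => f (F.cellMap (List.ofFn τ) x)) (F.normalizedHausdorff d) :=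
      (f.continuous.comp (hF.continuous_cellMap τ)).integrable_of_hasCompactSupport
        (.of_compactSpace _)
    refine abs_sub_integral_le hint fun x => (hf ?_).le
    rw [hF.dist_cellMap]
    exact (mul_le_mul_of_nonneg_left (hC p.2 x.2) (pow_pos hF.lam_pos n).le).trans_lt hn
  calc dist (((k : ℝ) ^ n)⁻¹ * ∑ τ : Fin n → Fin k, f (F.cellMap (List.ofFn τ) p))
        (∫ x, f x ∂F.normalizedHausdorff d)
      = ((k : ℝ) ^ n)⁻¹ * |∑ τ : Fin n → Fin k, (f (F.cellMap (List.ofFn τ) p) -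
          ∫ x, f (F.cellMap (List.ofFn τ) x) ∂F.normalizedHausdorff d)| := by
        rw [← hF.sum_integral_cellMap hU hd₀ hd f n, Real.dist_eq, ← mul_sub,
          ← Finset.sum_sub_distrib, abs_mul, abs_of_pos (inv_pos.2 (pow_pos hk n))]
    _ ≤ ((k : ℝ) ^ n)⁻¹ * ∑ _τ : Fin n → Fin k, ε / 2 := by
        gcongr
        exact (Finset.abs_sum_le_sum_abs _ _).trans (Finset.sum_le_sum fun τ _ => hcell τ)
    _ = ε / 2 := by
        rw [Finset.sum_const, Finset.card_univ, Fintype.card_fun, Fintype.card_fin,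
          Fintype.card_fin, nsmul_eq_mul, Nat.cast_pow, inv_mul_cancel_left₀ (pow_pos hk n).ne']
    _ < ε := half_lt_self hε

end IsHomogeneous

end SelfSimilarFractal

theorem exists_lp_comp_equiv {ι κ 𝕜 E : Type*} [NormedField 𝕜] [NormedAddCommGroup E]
    [NormedSpace 𝕜 E] {p : ℝ≥0∞} [Fact (1 ≤ p)] (hp : p ≠ ∞) (e : ι ≃ κ) :
    ∃ P : lp (fun _ : κ => E) p →L[𝕜] lp (fun _ : ι => E) p, ∀ ξ x, P ξ x = ξ (e x) := by
  have hp₀ : 0 < p.toReal :=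
    ENNReal.toReal_pos (zero_lt_one.trans_le (Fact.out : 1 ≤ p)).ne' hp
  have hmem (ξ : lp (fun _ : κ => E) p) : Memℓp (fun x => ξ (e x)) p :=
    (memℓp_gen_iff hp₀).2 (e.summable_iff.2 ((memℓp_gen_iff hp₀).1 (lp.memℓp ξ)))
  refine ⟨LinearMap.mkContinuous
    { toFun := fun ξ => ⟨fun x => ξ (e x), hmem ξ⟩
      map_add' := fun _ _ => rfl
      map_smul' := fun _ _ => rfl } 1 fun ξ => ?_, fun _ _ => rfl⟩
  rw [one_mul, lp.norm_eq_tsum_rpow hp₀, lp.norm_eq_tsum_rpow hp₀]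
  exact (congrArg (· ^ _) (e.tsum_eq fun x => ‖ξ x‖ ^ p.toReal)).le

section WordSums

variable {α : Type*} [Fintype α]

theorem sum_fun_pow {R : Type*} [CommSemiring R] (z : R) (n : ℕ) :
    ∑ _τ : Fin n → α, z ^ n = (Fintype.card α * z) ^ n := by
  simp only [Finset.sum_const, Finset.card_univ, Fintype.card_fun, Fintype.card_fin, nsmul_eq_mul,
    Nat.cast_pow, mul_pow]

theorem summable_pow_length_iff {q : ℝ} (hq : 0 ≤ q) :
    Summable (fun σ : List α => q ^ σ.length) ↔ Fintype.card α * q < 1 := by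
  rw [← (List.equivSigmaTuple (α := α)).symm.summable_iff]
  simp only [Function.comp_def, List.equivSigmaTuple, Equiv.coe_fn_symm_mk, List.length_ofFn]
  rw [summable_sigma_of_nonneg fun p => pow_nonneg hq p.1]
  simp only [tsum_fintype, sum_fun_pow]
  rw [summable_geometric_iff_norm_lt_one, Real.norm_of_nonneg (by positivity)]
  exact and_iff_right fun n => (hasSum_fintype _).summable

theorem tsum_pow_length {z : ℂ} (hz : Fintype.card α * ‖z‖ < 1) :
    ∑' σ : List α, z ^ σ.length = (1 - Fintype.card α * z)⁻¹ := by
  have hs : Summable fun σ : List α => z ^ σ.length := .of_norm <| by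
    simpa only [norm_pow] using (summable_pow_length_iff (norm_nonneg z)).2 hz
  rw [← (List.equivSigmaTuple (α := α)).symm.summable_iff] at hs
  rw [← (List.equivSigmaTuple (α := α)).symm.tsum_eq]
  simp only [Function.comp_def, List.equivSigmaTuple, Equiv.coe_fn_symm_mk,
    List.length_ofFn] at hs ⊢
  rw [hs.tsum_sigma]
  simp only [tsum_fintype, sum_fun_pow]
  exact tsum_geometric_of_norm_lt_one (by simpa using hz)

end WordSums

namespace SelfSimilarFractal

section Dirac

variable {N k : ℕ} (F : SelfSimilarFractal N k)

/-- The standard basis of the Hilbert space of the spectral triple. -/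
noncomputable def basis : HilbertBasis F.Index ℂ F.Hilb :=
  HilbertBasis.ofRepr (LinearIsometryEquiv.refl ℂ F.Hilb)

/-- Reversal of the orientation of an edge of any level. -/
def revIndex (x : F.Index) : F.Index := (x.1, x.2.rev)

theorem revIndex_involutive : Function.Involutive F.revIndex := fun _ => rfl

theorem indexLen_revIndex (x : F.Index) : F.indexLen (F.revIndex x) = F.indexLen x := by
  simp only [indexLen, revIndex, Edge.len, Edge.rev, dist_comm]

variable {F} in
theorem Edge.len_pos (e : F.Edge) : 0 < e.len := dist_pos.2 e.2.2.2

theorem indexLen_pos (x : F.Index) : 0 < F.indexLen x :=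
  mul_pos (F.ratioWord_pos x.1) x.2.len_pos

theorem indexLen_ne_zero (x : F.Index) : (F.indexLen x : ℂ) ≠ 0 :=
  Complex.ofReal_ne_zero.2 (F.indexLen_pos x).ne'

theorem ratioWord_le_one (σ : List (Fin k)) : F.ratioWord σ ≤ 1 := by
  induction σ with
  | nil => exact List.prod_nil.le
  | cons i σ ih =>
    rw [ratioWord, List.map_cons, List.prod_cons]
    exact mul_le_one₀ (F.ratio_lt_one i).le (F.ratioWord_pos σ).le ih

theorem indexLen_le (x : F.Index) : F.indexLen x ≤ ∑ e : F.Edge, e.len :=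
  (mul_le_of_le_one_left x.2.len_pos.le (F.ratioWord_le_one x.1)).trans <|
    Finset.single_le_sum (fun e _ => e.len_pos.le) (Finset.mem_univ x.2)

theorem isBoundedInverse_dirac {B : F.Hilb →L[ℂ] F.Hilb}
    (hB : ∀ ξ x, B ξ x = F.indexLen x * ξ (F.revIndex x)) : IsBoundedInverse F.dirac B := by
  rintro ⟨ξ, η⟩
  rw [LinearPMap.mem_graph_iff]
  constructor
  · rintro ⟨ζ, rfl : (ζ : F.Hilb) = ξ, rfl : F.dirac ζ = η⟩
    refine lp.ext (funext fun x => (hB _ x).trans ?_)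
    have hD : F.dirac ζ (F.revIndex x) =
        (((F.indexLen (F.revIndex x))⁻¹ : ℝ) : ℂ) * (ζ : F.Hilb) x := rfl
    rw [hD, indexLen_revIndex, Complex.ofReal_inv, mul_inv_cancel_left₀ (F.indexLen_ne_zero x)]
  · rintro (rfl : B η = ξ)
    have hη (x : F.Index) : (((F.indexLen x)⁻¹ : ℝ) : ℂ) * B η (F.revIndex x) = η x := by
      rw [hB, F.revIndex_involutive x, indexLen_revIndex, Complex.ofReal_inv,
        inv_mul_cancel_left₀ (F.indexLen_ne_zero x)]
    have hmem : B η ∈ F.dirac.domain :=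
      (congrArg (Memℓp · 2) (funext hη)).mpr (lp.memℓp η)
    exact ⟨⟨B η, hmem⟩, rfl, lp.ext (funext hη)⟩

theorem exists_isBoundedInverse_dirac : ∃ B : F.Hilb →L[ℂ] F.Hilb, IsBoundedInverse F.dirac B ∧
    ∀ ξ x, F.basis.repr (B ξ) x = F.indexLen x * F.basis.repr ξ (F.revIndex x) := by
  obtain ⟨P, hP⟩ := exists_lp_comp_equiv (𝕜 := ℂ) (E := ℂ) (p := 2) ENNReal.ofNat_ne_top
    (F.revIndex_involutive.toPerm F.revIndex)
  obtain ⟨T, hT, -⟩ := IsDiagonal.exists_of_bounded F.basis (a := fun x => (F.indexLen x : ℂ))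
    (C := ∑ e : F.Edge, e.len) (Finset.sum_nonneg fun e _ => e.len_pos.le) fun x => by
      rw [Complex.norm_real, Real.norm_of_nonneg (F.indexLen_pos x).le]
      exact F.indexLen_le x
  have hTP (ξ : F.Hilb) (x : F.Index) :
      (T ∘L P) ξ x = F.indexLen x * ξ (F.revIndex x) :=
    (hT (P ξ) x).trans (congrArg _ (hP ξ x))
  exact ⟨T ∘L P, F.isBoundedInverse_dirac hTP, hTP⟩

theorem isDiagonal_absNegPow_dirac {s : ℂ} (hs : 0 < s.re) :
    IsDiagonal F.basis (absNegPow F.dirac s) fun x => (F.indexLen x : ℂ) ^ s :=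
  let ⟨_, hD, hB⟩ := F.exists_isBoundedInverse_dirac
  isDiagonal_absNegPow hD F.revIndex_involutive F.indexLen_revIndex hB
    (fun x => (F.indexLen_pos x).le) hs

theorem isDiagonal_absNegPow_dirac_ofReal {d : ℝ} (hd₀ : 0 < d) :
    IsDiagonal F.basis (absNegPow F.dirac d) fun x => ((F.indexLen x ^ d : ℝ) : ℂ) := by
  simpa only [Complex.ofReal_cpow (F.indexLen_pos _).le] using
    F.isDiagonal_absNegPow_dirac (s := d) hd₀

theorem isDiagonal_rep (f : C(F.K, ℂ)) :
    IsDiagonal F.basis (F.rep f) fun x => f (F.indexPoint x) :=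
  fun _ _ => rfl

end Dirac

variable {N k : ℕ} {F : SelfSimilarFractal N k} {lam d : ℝ}

theorem nonempty_edge_of_nontrivial_V₀ (hV : F.V₀.Nontrivial) : Nonempty F.Edge :=
  let ⟨p, hp, q, hq, hpq⟩ := hV
  ⟨⟨(p, q), hp, hq, hpq⟩⟩

theorem edgeSum_ofReal (s : ℝ) : F.edgeSum s = (∑ e : F.Edge, e.len ^ s : ℝ) := by
  rw [edgeSum, Complex.ofReal_sum]
  exact Finset.sum_congr rfl fun e _ => (Complex.ofReal_cpow e.len_pos.le s).symm

theorem edgeSum_ofReal_ne_zero [Nonempty F.Edge] (s : ℝ) : F.edgeSum s ≠ 0 := by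
  rw [edgeSum_ofReal]
  exact Complex.ofReal_ne_zero.2 (Finset.sum_pos
    (fun (e : F.Edge) _ => Real.rpow_pos_of_pos e.len_pos s) Finset.univ_nonempty).ne'

theorem analyticAt_edgeSum (z : ℂ) : AnalyticAt ℂ F.edgeSum z :=
  Differentiable.analyticAt (Differentiable.fun_sum fun e _ _ =>
    differentiableAt_id.const_cpow (.inl (Complex.ofReal_ne_zero.2 e.len_pos.ne'))) z

namespace IsHomogeneous

theorem dim_pos (hF : F.IsHomogeneous lam) (hk : 1 < k)
    (hd : d = Real.log k / Real.log (1 / lam)) : 0 < d := by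
  rw [hd]
  exact div_pos (Real.log_pos (Nat.one_lt_cast.2 hk))
    (Real.log_pos (one_lt_one_div hF.lam_pos hF.lam_lt_one))

theorem card_mul_rpow_dim (hF : F.IsHomogeneous lam)
    (hd : d = Real.log k / Real.log (1 / lam)) : (k : ℝ) * lam ^ d = 1 := by
  have hk : (0 : ℝ) < k := Nat.cast_pos.2 (Fin.pos_iff_nonempty.2 F.nonempty_alphabet)
  have hpow : (1 / lam) ^ d = k := by
    rw [hd, Real.log_div_log]
    exact Real.rpow_logb (one_div_pos.2 hF.lam_pos)
      (one_lt_one_div hF.lam_pos hF.lam_lt_one).ne' hk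
  rw [← hpow, ← Real.mul_rpow (one_div_pos.2 hF.lam_pos).le hF.lam_pos.le,
    one_div_mul_cancel hF.lam_pos.ne', Real.one_rpow]

theorem indexLen_cpow (hF : F.IsHomogeneous lam) (x : F.Index) (s : ℂ) :
    (F.indexLen x : ℂ) ^ s = ((lam : ℂ) ^ s) ^ x.1.length * (x.2.len : ℂ) ^ s := by
  rw [indexLen, Complex.ofReal_mul, Complex.mul_cpow_ofReal_nonneg (F.ratioWord_pos _).le
    x.2.len_pos.le, hF.ratioWord_eq, Complex.ofReal_pow]
  have harg : (lam : ℂ).arg = 0 := Complex.arg_ofReal_of_nonneg hF.lam_pos.le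
  rw [← Complex.cpow_nat_mul' (by simp [harg, Real.pi_pos]) (by simp [harg, Real.pi_pos.le]),
    Complex.cpow_nat_mul]

theorem indexLen_rpow (hF : F.IsHomogeneous lam) (x : F.Index) (s : ℝ) :
    F.indexLen x ^ s = (lam ^ s) ^ x.1.length * x.2.len ^ s := by
  rw [indexLen, Real.mul_rpow (F.ratioWord_pos _).le x.2.len_pos.le, hF.ratioWord_eq,
    ← Real.rpow_pow_comm hF.lam_pos.le]

theorem card_mul_rpow_lt_one_iff (hF : F.IsHomogeneous lam) (hd : (k : ℝ) * lam ^ d = 1) (s : ℝ) :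
    k * lam ^ s < 1 ↔ d < s := by
  have hk : (0 : ℝ) < k := Nat.cast_pos.2 (Fin.pos_iff_nonempty.2 F.nonempty_alphabet)
  rw [← hd, mul_lt_mul_iff_right₀ hk,
    Real.rpow_lt_rpow_left_iff_of_base_lt_one hF.lam_pos hF.lam_lt_one]

theorem summable_norm_indexLen_cpow_iff [Nonempty F.Edge] (hF : F.IsHomogeneous lam)
    (hd : (k : ℝ) * lam ^ d = 1) (s : ℂ) :
    (Summable fun x : F.Index => ‖(F.indexLen x : ℂ) ^ s‖) ↔ d < s.re := by
  have hq : 0 ≤ lam ^ s.re := Real.rpow_nonneg hF.lam_pos.le _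
  have hwords : (Summable fun σ : List (Fin k) => (lam ^ s.re) ^ σ.length) ↔ d < s.re := by
    rw [summable_pow_length_iff hq, Fintype.card_fin, hF.card_mul_rpow_lt_one_iff hd]
  simp only [Complex.norm_cpow_eq_rpow_re_of_pos (F.indexLen_pos _), hF.indexLen_rpow]
  rw [← hwords]
  constructor
  · intro h
    obtain ⟨e⟩ := ‹Nonempty F.Edge›
    have hcol := h.comp_injective (i := fun σ : List (Fin k) => (σ, e))
      fun _ _ h => congrArg Prod.fst h
    exact (summable_mul_right_iff (Real.rpow_pos_of_pos e.len_pos s.re).ne').1 hcol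
  · exact fun h => h.mul_of_nonneg (hasSum_fintype fun e : F.Edge => e.len ^ s.re).summable
      (fun σ => pow_nonneg hq _) fun e => Real.rpow_nonneg e.len_pos.le _

theorem tsum_indexLen_cpow (hF : F.IsHomogeneous lam) (hd : (k : ℝ) * lam ^ d = 1) {s : ℂ}
    (hs : d < s.re) :
    ∑' x : F.Index, (F.indexLen x : ℂ) ^ s = F.edgeSum s / (1 - (k : ℂ) * (lam : ℂ) ^ s) := by
  have hz : (Fintype.card (Fin k) : ℝ) * ‖(lam : ℂ) ^ s‖ < 1 := by
    rwa [Fintype.card_fin, Complex.norm_cpow_eq_rpow_re_of_pos hF.lam_pos,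
      hF.card_mul_rpow_lt_one_iff hd]
  have hwords : Summable fun σ : List (Fin k) => ‖((lam : ℂ) ^ s) ^ σ.length‖ := by
    simpa only [norm_pow] using (summable_pow_length_iff (norm_nonneg _)).2 hz
  simp only [hF.indexLen_cpow]
  rw [← tsum_mul_tsum_of_summable_norm hwords
    (hasSum_fintype fun e : F.Edge => ‖(e.len : ℂ) ^ s‖).summable, tsum_pow_length hz,
    Fintype.card_fin, tsum_fintype, edgeSum, mul_comm, div_eq_mul_inv]

theorem isTraceClass_absNegPow_dirac_iff [Nonempty F.Edge] (hF : F.IsHomogeneous lam)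
    (hd : (k : ℝ) * lam ^ d = 1) {s : ℂ} (hs : 0 < s.re) :
    IsTraceClass (absNegPow F.dirac s) ↔ d < s.re :=
  (F.isDiagonal_absNegPow_dirac hs).isTraceClass_iff.trans (hF.summable_norm_indexLen_cpow_iff hd s)

theorem metricDim_dirac [Nonempty F.Edge] (hF : F.IsHomogeneous lam) (hd₀ : 0 < d)
    (hd : (k : ℝ) * lam ^ d = 1) : metricDim F.dirac = d := by
  have hset : {s : ℝ | 0 < s ∧ IsTraceClass (absNegPow F.dirac (s : ℂ))} = Set.Ioi d := by
    ext s
    refine Iff.trans ?_ (and_iff_right_of_imp hd₀.trans)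
    exact and_congr_right fun hs => hF.isTraceClass_absNegPow_dirac_iff hd (s := s) hs
  rw [metricDim, hset, csInf_Ioi]

theorem zetaFun_dirac [Nonempty F.Edge] (hF : F.IsHomogeneous lam) (hd₀ : 0 < d)
    (hd : (k : ℝ) * lam ^ d = 1) {s : ℂ} (hs : d < s.re) :
    zetaFun F.dirac s = F.edgeSum s / (1 - (k : ℂ) * (lam : ℂ) ^ s) :=
  ((F.isDiagonal_absNegPow_dirac (hd₀.trans hs)).opTrace_eq
    ((hF.summable_norm_indexLen_cpow_iff hd s).2 hs)).trans (hF.tsum_indexLen_cpow hd hs)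

end IsHomogeneous

section NoncommutativeIntegral

variable {N k : ℕ} (F : SelfSimilarFractal N k)

/-- The edges of level less than `n`. -/
noncomputable def indexLT (n : ℕ) : Finset F.Index :=
  (((Finset.range n).sigma fun m => (Finset.univ : Finset (Fin m → Fin k))).map
    (List.equivSigmaTuple (α := Fin k)).symm.toEmbedding) ×ˢ Finset.univ

theorem mem_indexLT {n : ℕ} {x : F.Index} : x ∈ F.indexLT n ↔ x.1.length < n := by
  rw [indexLT, Finset.mem_product, Finset.mem_map_equiv]
  simp [List.equivSigmaTuple]

theorem sum_indexLT (n : ℕ) (g : F.Index → ℝ) : ∑ x ∈ F.indexLT n, g x =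
    ∑ m ∈ Finset.range n, ∑ τ : Fin m → Fin k, ∑ e : F.Edge, g (List.ofFn τ, e) := by
  rw [indexLT, Finset.sum_product, Finset.sum_map, Finset.sum_sigma]
  rfl

theorem card_indexLT_le (hk : 1 < k) (n : ℕ) :
    (F.indexLT n).card ≤ Fintype.card F.Edge * k ^ n := by
  rw [indexLT, Finset.card_product, Finset.card_map, Finset.card_sigma, Finset.card_univ, mul_comm]
  refine Nat.mul_le_mul_left _ ?_
  simp only [Finset.card_univ, Fintype.card_fun, Fintype.card_fin]
  exact (Nat.geomSum_lt hk fun m hm => Finset.mem_range.1 hm).le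

theorem strictMono_card_edge_mul_pow [Nonempty F.Edge] (hk : 1 < k) :
    StrictMono fun n => Fintype.card F.Edge * k ^ n :=
  (pow_right_strictMono₀ hk).const_mul Fintype.card_pos

theorem tendsto_log_card_edge_mul_pow_div [Nonempty F.Edge] (hk : 0 < k) :
    Tendsto (fun n : ℕ => Real.log (Fintype.card F.Edge * k ^ n : ℕ) / n) atTop
      (𝓝 (Real.log k)) := by
  have hE : (Fintype.card F.Edge : ℝ) ≠ 0 := Nat.cast_ne_zero.2 Fintype.card_ne_zero
  have hk₀ : (k : ℝ) ≠ 0 := Nat.cast_ne_zero.2 hk.ne'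
  have hlim := (tendsto_const_div_atTop_nhds_zero_nat (Real.log (Fintype.card F.Edge))).add_const
    (Real.log k)
  rw [zero_add] at hlim
  refine hlim.congr' ?_
  filter_upwards [eventually_ne_atTop 0] with n hn
  rw [Nat.cast_mul, Nat.cast_pow, Real.log_mul hE (pow_ne_zero n hk₀), Real.log_pow, add_div,
    mul_div_cancel_left₀ _ (Nat.cast_ne_zero.2 hn)]

variable {F} {lam d : ℝ}

theorem sum_len_rpow_nonneg (s : ℝ) : 0 ≤ ∑ e : F.Edge, e.len ^ s :=
  Finset.sum_nonneg fun e _ => Real.rpow_nonneg e.len_pos.le s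

namespace IsHomogeneous

theorem one_lt_card (hF : F.IsHomogeneous lam) (hd₀ : 0 < d) (hd : (k : ℝ) * lam ^ d = 1) :
    1 < k := by
  by_contra! hk
  refine hd.not_lt (lt_of_le_of_lt ?_ (Real.rpow_lt_one hF.lam_pos.le hF.lam_lt_one hd₀))
  exact mul_le_of_le_one_left (Real.rpow_nonneg hF.lam_pos.le d) (Nat.cast_le_one.2 hk)

theorem pow_mul_indexLen_rpow_le (hF : F.IsHomogeneous lam) (hd₀ : 0 < d)
    (hd : (k : ℝ) * lam ^ d = 1) {n : ℕ} {x : F.Index} (hx : x ∉ F.indexLT n) :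
    (k : ℝ) ^ n * F.indexLen x ^ d ≤ ∑ e : F.Edge, e.len ^ d := by
  have hlam : 0 ≤ lam ^ d := Real.rpow_nonneg hF.lam_pos.le d
  calc (k : ℝ) ^ n * F.indexLen x ^ d
      ≤ k ^ n * ((lam ^ d) ^ n * x.2.len ^ d) := by
        rw [hF.indexLen_rpow]
        have hpow : (lam ^ d) ^ x.1.length ≤ (lam ^ d) ^ n :=
          pow_le_pow_of_le_one hlam (Real.rpow_le_one hF.lam_pos.le hF.lam_lt_one.le hd₀.le)
            (not_lt.1 (mt F.mem_indexLT.2 hx))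
        gcongr
        exact Real.rpow_nonneg x.2.len_pos.le d
    _ = x.2.len ^ d := by rw [← mul_assoc, ← mul_pow, hd, one_pow, one_mul]
    _ ≤ ∑ e : F.Edge, e.len ^ d :=
        Finset.single_le_sum (f := fun e : F.Edge => e.len ^ d)
          (fun e _ => Real.rpow_nonneg e.len_pos.le d) (Finset.mem_univ x.2)

theorem tendsto_indexLen_rpow_dim (hF : F.IsHomogeneous lam) (hd₀ : 0 < d)
    (hd : (k : ℝ) * lam ^ d = 1) :
    Tendsto (fun x : F.Index => ((F.indexLen x ^ d : ℝ) : ℂ)) cofinite (𝓝 0) := by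
  have hk : (1 : ℝ) < k := Nat.one_lt_cast.2 (hF.one_lt_card hd₀ hd)
  rw [Metric.tendsto_nhds]
  intro ε hε
  obtain ⟨n, hn⟩ := (((tendsto_pow_atTop_atTop_of_one_lt hk).const_div_atTop
    (∑ e : F.Edge, e.len ^ d)).eventually_lt_const hε).exists
  refine eventually_cofinite.2 ((F.indexLT n).finite_toSet.subset fun x hx => ?_)
  by_contra hxn
  refine hx (lt_of_le_of_lt ?_ hn)
  rw [dist_zero_right, Complex.norm_real,
    Real.norm_of_nonneg (Real.rpow_nonneg (F.indexLen_pos x).le _)]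
  exact (le_div_iff₀' (by positivity)).2 (hF.pow_mul_indexLen_rpow_le hd₀ hd hxn)

theorem tendsto_sum_indexLT_div (hF : F.IsHomogeneous lam) (hU : F.OpenSetCondition) (hd₀ : 0 < d)
    (hd : (k : ℝ) * lam ^ d = 1) (g : C(F.K, ℝ)) :
    Tendsto (fun n : ℕ => (∑ x ∈ F.indexLT n, g (F.indexPoint x) * F.indexLen x ^ d) / n) atTop
      (𝓝 ((∑ e : F.Edge, e.len ^ d) * ∫ x, g x ∂F.normalizedHausdorff d)) := by
  have hlevel : Tendsto (fun m : ℕ => ∑ e : F.Edge, e.len ^ d * (((k : ℝ) ^ m)⁻¹ *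
      ∑ τ : Fin m → Fin k, g (F.cellMap (List.ofFn τ) ⟨e.1.1, F.V₀_subset e.2.1⟩))) atTop
      (𝓝 (∑ e : F.Edge, e.len ^ d * ∫ x, g x ∂F.normalizedHausdorff d)) :=
    tendsto_finsetSum _ fun e _ => (hF.tendsto_average hU hd₀ hd g _).const_mul _
  rw [Finset.sum_mul]
  refine hlevel.cesaro.congr fun n => ?_
  rw [div_eq_inv_mul, F.sum_indexLT]
  refine congrArg _ (Finset.sum_congr rfl fun m _ => ?_)
  simp only [Finset.mul_sum]
  rw [Finset.sum_comm]
  refine Finset.sum_congr rfl fun τ _ => Finset.sum_congr rfl fun e _ => ?_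
  rw [hF.indexLen_rpow, List.length_ofFn, eq_inv_of_mul_eq_one_right hd, inv_pow, mul_left_comm,
    mul_left_comm (g _), mul_comm (g _)]
  rfl

theorem tendsto_logMean [Nonempty F.Edge] (hF : F.IsHomogeneous lam) (hU : F.OpenSetCondition)
    (hd₀ : 0 < d) (hd : (k : ℝ) * lam ^ d = 1) {g : C(F.K, ℝ)} (hg : 0 ≤ g)
    {T : F.Hilb →L[ℂ] F.Hilb}
    (hT : IsDiagonal F.basis T fun x => ((g (F.indexPoint x) * F.indexLen x ^ d : ℝ) : ℂ)) :
    Tendsto (logMean T) atTop (𝓝 ((1 / Real.log k * ∑ e : F.Edge, e.len ^ d) *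
      ∫ x, g x ∂F.normalizedHausdorff d)) := by
  have : CompactSpace F.K := isCompact_iff_compactSpace.1 F.isCompact_K
  have hk := hF.one_lt_card hd₀ hd
  have hlen (x : F.Index) : 0 ≤ F.indexLen x ^ d := Real.rpow_nonneg (F.indexLen_pos x).le d
  have hnorm (x : F.Index) : ‖((g (F.indexPoint x) * F.indexLen x ^ d : ℝ) : ℂ)‖ =
      g (F.indexPoint x) * F.indexLen x ^ d :=
    (Complex.norm_real _).trans (Real.norm_of_nonneg (mul_nonneg (hg _) (hlen x)))
  have htail (n : ℕ) (x : F.Index) (hx : x ∉ F.indexLT n) :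
      ((Fintype.card F.Edge * k ^ n : ℕ) : ℝ) * (g (F.indexPoint x) * F.indexLen x ^ d) ≤
        Fintype.card F.Edge * ‖g‖ * ∑ e : F.Edge, e.len ^ d := by
    calc ((Fintype.card F.Edge * k ^ n : ℕ) : ℝ) * (g (F.indexPoint x) * F.indexLen x ^ d)
        = Fintype.card F.Edge * g (F.indexPoint x) * (k ^ n * F.indexLen x ^ d) := by
          push_cast
          ring
      _ ≤ _ := by
          gcongr
          · exact mul_nonneg (by positivity) (hlen x)
          · exact (le_abs_self _).trans (g.norm_coe_le_norm _)
          · exact hF.pow_mul_indexLen_rpow_le hd₀ hd hx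
  rw [one_div_mul_eq_div, div_mul_eq_mul_div]
  refine hT.tendsto_logMean (C := Fintype.card F.Edge * ‖g‖ * ∑ e : F.Edge, e.len ^ d)
    (F.strictMono_card_edge_mul_pow hk) (F.card_indexLT_le hk) (fun n x hx => ?_)
    (Real.log_pos (Nat.one_lt_cast.2 hk)).ne' ?_
    (F.tendsto_log_card_edge_mul_pow_div (zero_lt_one.trans hk))
  · simpa only [hnorm] using htail n x hx
  · simpa only [hnorm] using hF.tendsto_sum_indexLT_div hU hd₀ hd g

theorem inMacaevIdeal_absNegPow_dirac [Nonempty F.Edge] (hF : F.IsHomogeneous lam)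
    (hU : F.OpenSetCondition) (hd₀ : 0 < d) (hd : (k : ℝ) * lam ^ d = 1) :
    InMacaevIdeal (absNegPow F.dirac (d : ℂ)) := by
  have hT := F.isDiagonal_absNegPow_dirac_ofReal hd₀
  refine ⟨hT.isCompactOperator (hF.tendsto_indexLen_rpow_dim hd₀ hd),
    exists_norm_logMean_le_of_tendsto
      (hF.tendsto_logMean hU hd₀ hd (g := 1) zero_le_one (hT.congr fun x => ?_))⟩
  rw [ContinuousMap.one_apply, one_mul]

theorem integrable_normalizedHausdorff (hF : F.IsHomogeneous lam) (hU : F.OpenSetCondition)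
    (hd₀ : 0 < d) (hd : (k : ℝ) * lam ^ d = 1) {E : Type*} [NormedAddCommGroup E] (f : C(F.K, E)) :
    Integrable f (F.normalizedHausdorff d) := by
  have := isCompact_iff_compactSpace.1 F.isCompact_K
  have := hF.isProbabilityMeasure_normalizedHausdorff hU hd₀ hd
  exact f.continuous.integrable_of_hasCompactSupport (.of_compactSpace f)

theorem tendsto_logMean_posPart [Nonempty F.Edge] (hF : F.IsHomogeneous lam)
    (hU : F.OpenSetCondition) (hd₀ : 0 < d) (hd : (k : ℝ) * lam ^ d = 1) (g : C(F.K, ℝ))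
    {T : F.Hilb →L[ℂ] F.Hilb} {a : F.Index → ℝ}
    (ha : ∀ x, a x = g (F.indexPoint x) * F.indexLen x ^ d)
    (hT : IsDiagonal F.basis T fun x => (((a x)⁺ : ℝ) : ℂ)) :
    Tendsto (logMean T) atTop (𝓝 ((1 / Real.log k * ∑ e : F.Edge, e.len ^ d) *
      ∫ x, g⁺ x ∂F.normalizedHausdorff d)) := by
  refine hF.tendsto_logMean hU hd₀ hd (posPart_nonneg g) (hT.congr fun x => congrArg _ ?_)
  have hlen : 0 ≤ F.indexLen x ^ d := Real.rpow_nonneg (F.indexLen_pos x).le d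
  calc (a x)⁺ = max (g (F.indexPoint x) * F.indexLen x ^ d) (0 * F.indexLen x ^ d) := by
        rw [ha, zero_mul]
        rfl
    _ = g⁺ (F.indexPoint x) * F.indexLen x ^ d := (max_mul_of_nonneg _ _ hlen).symm

theorem integral_posPart_sub_integral_negPart (hF : F.IsHomogeneous lam)
    (hU : F.OpenSetCondition) (hd₀ : 0 < d) (hd : (k : ℝ) * lam ^ d = 1) (g : C(F.K, ℝ)) :
    ∫ x, g⁺ x ∂F.normalizedHausdorff d - ∫ x, (-g)⁺ x ∂F.normalizedHausdorff d =
      ∫ x, g x ∂F.normalizedHausdorff d := by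
  rw [← integral_sub (hF.integrable_normalizedHausdorff hU hd₀ hd _)
    (hF.integrable_normalizedHausdorff hU hd₀ hd _)]
  simp only [← ContinuousMap.sub_apply, posPart_neg, posPart_sub_negPart]

theorem ncIntegral_rep [Nonempty F.Edge] (hF : F.IsHomogeneous lam) (hU : F.OpenSetCondition)
    (hd₀ : 0 < d) (hd : (k : ℝ) * lam ^ d = 1) (ω : GeneralizedLimit) (f : C(F.K, ℂ)) :
    ncIntegral F.dirac ω (F.rep f) =
      ((1 / Real.log k * ∑ e : F.Edge, e.len ^ d : ℝ) : ℂ) *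
        ∫ x, f x ∂F.normalizedHausdorff d := by
  have hT := (F.isDiagonal_rep f).mul (F.isDiagonal_absNegPow_dirac_ofReal hd₀)
  let re : C(F.K, ℝ) := ⟨fun x => (f x).re, Complex.continuous_re.comp f.continuous⟩
  let im : C(F.K, ℝ) := ⟨fun x => (f x).im, Complex.continuous_im.comp f.continuous⟩
  have hre (x : F.Index) : (f (F.indexPoint x) * ((F.indexLen x ^ d : ℝ) : ℂ)).re =
      re (F.indexPoint x) * F.indexLen x ^ d := Complex.re_mul_ofReal _ _
  have him (x : F.Index) : (f (F.indexPoint x) * ((F.indexLen x ^ d : ℝ) : ℂ)).im =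
      im (F.indexPoint x) * F.indexLen x ^ d := Complex.im_mul_ofReal _ _
  have hf : ∫ x, f x ∂F.normalizedHausdorff d =
      ((∫ x, re x ∂F.normalizedHausdorff d : ℝ) : ℂ) +
        ((∫ x, im x ∂F.normalizedHausdorff d : ℝ) : ℂ) * Complex.I :=
    (integral_re_add_im (hF.integrable_normalizedHausdorff hU hd₀ hd f)).symm
  rw [ncIntegral, hF.metricDim_dirac hd₀ hd, hT.dixmierTrace_eq ω
    (fun _ => hF.tendsto_logMean_posPart hU hd₀ hd re hre)
    (fun _ => hF.tendsto_logMean_posPart hU hd₀ hd (-re) fun x =>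
      (congrArg Neg.neg (hre x)).trans (neg_mul_eq_neg_mul _ _))
    (fun _ => hF.tendsto_logMean_posPart hU hd₀ hd im him)
    (fun _ => hF.tendsto_logMean_posPart hU hd₀ hd (-im) fun x =>
      (congrArg Neg.neg (him x)).trans (neg_mul_eq_neg_mul _ _)),
    ← mul_sub, ← mul_sub, hF.integral_posPart_sub_integral_negPart hU hd₀ hd,
    hF.integral_posPart_sub_integral_negPart hU hd₀ hd, hf]
  push_cast
  ring

theorem eq_smul_normalizedHausdorff [Nonempty F.Edge] (hF : F.IsHomogeneous lam)
    (hU : F.OpenSetCondition) (hd₀ : 0 < d) (hd : (k : ℝ) * lam ^ d = 1)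
    (ω : GeneralizedLimit) (ν : Measure F.K) [IsFiniteMeasure ν]
    (hν : ∀ f : C(F.K, ℂ), ncIntegral F.dirac ω (F.rep f) = ∫ x, f x ∂ν) :
    ν = ENNReal.ofReal (1 / Real.log k * ∑ e : F.Edge, e.len ^ d) • F.normalizedHausdorff d := by
  have := hF.isProbabilityMeasure_normalizedHausdorff hU hd₀ hd
  have hc : 0 ≤ 1 / Real.log k * ∑ e : F.Edge, e.len ^ d :=
    mul_nonneg (one_div_nonneg.2 (Real.log_natCast_nonneg k)) (sum_len_rpow_nonneg d)
  have := (F.normalizedHausdorff d).smul_finite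
    (ENNReal.ofReal_ne_top (r := 1 / Real.log k * ∑ e : F.Edge, e.len ^ d))
  refine ext_of_forall_integral_eq_of_IsFiniteMeasure fun f => ?_
  have hf := (hν ⟨fun x => (f x : ℂ), Complex.continuous_ofReal.comp f.continuous⟩).symm.trans
    (hF.ncIntegral_rep hU hd₀ hd ω _)
  simp only [ContinuousMap.coe_mk] at hf
  rw [integral_complex_ofReal, integral_complex_ofReal] at hf
  rw [integral_smul_measure, ENNReal.toReal_ofReal hc, smul_eq_mul]
  exact_mod_cast hf

end IsHomogeneous

end NoncommutativeIntegral

end SelfSimilarFractal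

section MeromorphicOrder

variable {𝕜 : Type*} [RCLike 𝕜] {f g : 𝕜 → 𝕜} {z : 𝕜}

theorem meromorphicOrderAt_div_eq_neg_one (hf : AnalyticAt 𝕜 f z) (hg : AnalyticAt 𝕜 g z)
    (hfz : f z ≠ 0) (hgz : g z = 0) (hg' : deriv g z ≠ 0) :
    meromorphicOrderAt (f / g) z = ((-1 : ℤ) : WithTop ℤ) := by
  rw [meromorphicOrderAt_div hf.meromorphicAt hg.meromorphicAt, hf.meromorphicOrderAt_eq,
    hg.meromorphicOrderAt_eq, hg.analyticOrderAt_eq_one_of_zero_deriv_ne_zero hgz hg',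
    hf.analyticOrderAt_eq_zero.2 hfz]
  rfl

theorem meromorphicOrderAt_div_nonneg_of_simple_zero (hf : AnalyticAt 𝕜 f z)
    (hg : AnalyticAt 𝕜 g z) (hfz : f z = 0) (hgz : g z = 0) (hg' : deriv g z ≠ 0) :
    0 ≤ meromorphicOrderAt (f / g) z := by
  rw [meromorphicOrderAt_div hf.meromorphicAt hg.meromorphicAt, hf.meromorphicOrderAt_eq,
    hg.meromorphicOrderAt_eq, hg.analyticOrderAt_eq_one_of_zero_deriv_ne_zero hgz hg']
  have hone : 1 ≤ analyticOrderAt f z :=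
    Order.one_le_iff_ne_zero.2 (hf.analyticOrderAt_ne_zero.2 hfz)
  generalize analyticOrderAt f z = m at hone
  cases m with
  | top => exact le_top
  | coe m =>
    have hm : (0 : ℤ) ≤ (m : ℤ) - 1 := sub_nonneg.2 (by exact_mod_cast hone)
    exact WithTop.coe_le_coe.2 hm

theorem meromorphicOrderAt_div_neg_iff (hf : AnalyticAt 𝕜 f z) (hg : AnalyticAt 𝕜 g z)
    (hg' : g z = 0 → deriv g z ≠ 0) :
    meromorphicOrderAt (f / g) z < 0 ↔ g z = 0 ∧ f z ≠ 0 := by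
  refine ⟨fun h => ?_, fun ⟨hgz, hfz⟩ => ?_⟩
  · have hgz : g z = 0 := by
      by_contra hgz
      exact h.not_ge (hf.div hg hgz).meromorphicOrderAt_nonneg
    exact ⟨hgz, fun hfz =>
      h.not_ge (meromorphicOrderAt_div_nonneg_of_simple_zero hf hg hfz hgz (hg' hgz))⟩
  · rw [meromorphicOrderAt_div_eq_neg_one hf hg hfz hgz (hg' hgz)]
    exact WithTop.coe_lt_coe.2 neg_one_lt_zero

theorem meromorphicOrderAt_eq_of_eventuallyEq (hf : Meromorphic f) (hg : Meromorphic g) {w : 𝕜}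
    (h : f =ᶠ[𝓝[≠] w] g) (z : 𝕜) : meromorphicOrderAt f z = meromorphicOrderAt g z := by
  have hfg : Meromorphic (f - g) := fun x => (hf x).sub (hg x)
  have hw : meromorphicOrderAt (f - g) w = ⊤ :=
    meromorphicOrderAt_eq_top_iff.2 (h.mono fun s hs => sub_eq_zero.2 hs)
  have hz : meromorphicOrderAt (f - g) z = ⊤ := by
    by_contra hz
    exact hfg.exists_meromorphicOrderAt_ne_top_iff_forall.1 ⟨z, hz⟩ w hw
  exact meromorphicOrderAt_congr ((meromorphicOrderAt_eq_top_iff.1 hz).mono fun s => sub_eq_zero.1)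

end MeromorphicOrder

theorem meromorphicOrderAt_eq_of_isMeromorphicExtension {H : Type*} [NormedAddCommGroup H]
    [InnerProductSpace ℂ H] [CompleteSpace H] {D : H →ₗ.[ℂ] H} {f g : ℂ → ℂ}
    (hf : IsMeromorphicExtension D f) (hg : IsMeromorphicExtension D g) (z : ℂ) :
    meromorphicOrderAt f z = meromorphicOrderAt g z := by
  have hnhds : {s : ℂ | metricDim D < s.re} ∈ 𝓝 ((metricDim D + 1 : ℝ) : ℂ) :=
    (isOpen_lt continuous_const Complex.continuous_re).mem_nhds (lt_add_one (metricDim D))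
  refine meromorphicOrderAt_eq_of_eventuallyEq hf.1 hg.1 (w := ((metricDim D + 1 : ℝ) : ℂ)) ?_ z
  filter_upwards [nhdsWithin_le_nhds hnhds] with s hs
  exact (hf.2 s hs).2.symm.trans (hg.2 s hs).2

namespace SelfSimilarFractal.IsHomogeneous

section Poles

variable {N k : ℕ} {F : SelfSimilarFractal N k} {lam d : ℝ}

theorem hasDerivAt_one_sub_card_mul_cpow (hF : F.IsHomogeneous lam) (z : ℂ) :
    HasDerivAt (fun s : ℂ => 1 - (k : ℂ) * (lam : ℂ) ^ s)
      (-(k * ((lam : ℂ) ^ z * Complex.log lam))) z := by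
  have hlam : (lam : ℂ) ≠ 0 := Complex.ofReal_ne_zero.2 hF.lam_pos.ne'
  simpa only [id, mul_one] using
    (((hasDerivAt_id z).const_cpow (Or.inl hlam)).const_mul (k : ℂ)).const_sub 1

theorem analyticAt_one_sub_card_mul_cpow (hF : F.IsHomogeneous lam) (z : ℂ) :
    AnalyticAt ℂ (fun s : ℂ => 1 - (k : ℂ) * (lam : ℂ) ^ s) z :=
  Differentiable.analyticAt
    (fun s => (hF.hasDerivAt_one_sub_card_mul_cpow s).differentiableAt) z

theorem deriv_one_sub_card_mul_cpow_ne_zero (hF : F.IsHomogeneous lam) (z : ℂ) :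
    deriv (fun s : ℂ => 1 - (k : ℂ) * (lam : ℂ) ^ s) z ≠ 0 := by
  have hlam : (lam : ℂ) ≠ 0 := Complex.ofReal_ne_zero.2 hF.lam_pos.ne'
  have hk : (k : ℂ) ≠ 0 := Nat.cast_ne_zero.2 (Fin.pos_iff_nonempty.2 F.nonempty_alphabet).ne'
  have hlog : Complex.log lam ≠ 0 := by
    rw [← Complex.ofReal_log hF.lam_pos.le]
    exact Complex.ofReal_ne_zero.2 (Real.log_neg hF.lam_pos hF.lam_lt_one).ne
  rw [(hF.hasDerivAt_one_sub_card_mul_cpow z).deriv]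
  exact neg_ne_zero.2
    (mul_ne_zero hk (mul_ne_zero (Complex.cpow_ne_zero_iff.2 (.inl hlam)) hlog))

theorem card_mul_cpow_eq_exp (hF : F.IsHomogeneous lam) (hd₀ : 0 < d)
    (hd : (k : ℝ) * lam ^ d = 1) (z : ℂ) :
    (k : ℂ) * (lam : ℂ) ^ z = Complex.exp (Real.log k * (1 - z / d)) := by
  have hk : (k : ℝ) ≠ 0 := Nat.cast_ne_zero.2 (zero_lt_one.trans (hF.one_lt_card hd₀ hd)).ne'
  have hlog : Real.log lam = -(Real.log k / d) := by
    rw [eq_inv_of_mul_eq_one_left hd, Real.log_inv, Real.log_rpow hF.lam_pos, neg_div, neg_neg,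
      mul_div_cancel_left₀ _ hd₀.ne']
  rw [Complex.cpow_def_of_ne_zero (Complex.ofReal_ne_zero.2 hF.lam_pos.ne'),
    ← Complex.ofReal_log hF.lam_pos.le, hlog, mul_one_sub, sub_eq_add_neg, Complex.exp_add,
    Complex.natCast_log, Complex.exp_log (by exact_mod_cast hk)]
  congr 2
  push_cast
  ring

theorem one_sub_card_mul_cpow_eq_zero_iff (hF : F.IsHomogeneous lam) (hd₀ : 0 < d)
    (hd : (k : ℝ) * lam ^ d = 1) (z : ℂ) :
    1 - (k : ℂ) * (lam : ℂ) ^ z = 0 ↔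
      ∃ n : ℤ, z = (d : ℂ) * (1 + 2 * Real.pi * Complex.I / (Real.log k : ℂ) * n) := by
  have hd₀' : (d : ℂ) ≠ 0 := Complex.ofReal_ne_zero.2 hd₀.ne'
  have hlog : (Real.log k : ℂ) ≠ 0 :=
    Complex.ofReal_ne_zero.2 (Real.log_pos (Nat.one_lt_cast.2 (hF.one_lt_card hd₀ hd))).ne'
  rw [sub_eq_zero, eq_comm, hF.card_mul_cpow_eq_exp hd₀ hd, Complex.exp_eq_one_iff,
    neg_surjective.exists]
  refine exists_congr fun n => ?_
  rw [Int.cast_neg]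
  constructor <;> intro h
  · field_simp at h ⊢
    linear_combination -h
  · rw [h]
    field_simp
    ring

theorem isMeromorphicExtension_zetaFun_dirac [Nonempty F.Edge] (hF : F.IsHomogeneous lam)
    (hd₀ : 0 < d) (hd : (k : ℝ) * lam ^ d = 1) : IsMeromorphicExtension F.dirac
      fun s : ℂ => F.edgeSum s / (1 - (k : ℂ) * (lam : ℂ) ^ s) := by
  refine ⟨fun z => ((analyticAt_edgeSum z).meromorphicAt).div
    (hF.analyticAt_one_sub_card_mul_cpow z).meromorphicAt, fun s hs => ?_⟩
  rw [hF.metricDim_dirac hd₀ hd] at hs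
  exact ⟨(hF.isTraceClass_absNegPow_dirac_iff hd (hd₀.trans hs)).2 hs,
    hF.zetaFun_dirac hd₀ hd hs⟩

theorem dimensionSpectrum_dirac [Nonempty F.Edge] (hF : F.IsHomogeneous lam) (hd₀ : 0 < d)
    (hd : (k : ℝ) * lam ^ d = 1) : dimensionSpectrum F.dirac =
      {z : ℂ | (∃ n : ℤ, z = (d : ℂ) * (1 + 2 * Real.pi * Complex.I / (Real.log k : ℂ) * n)) ∧
        F.edgeSum z ≠ 0} := by
  have hext := hF.isMeromorphicExtension_zetaFun_dirac hd₀ hd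
  ext z
  have hpole := meromorphicOrderAt_div_neg_iff (analyticAt_edgeSum (F := F) z)
    (hF.analyticAt_one_sub_card_mul_cpow z) fun _ => hF.deriv_one_sub_card_mul_cpow_ne_zero z
  rw [Set.mem_ofPred_eq, ← hF.one_sub_card_mul_cpow_eq_zero_iff hd₀ hd, ← hpole]
  constructor
  · rintro ⟨g, hg, hgz⟩
    rwa [meromorphicOrderAt_eq_of_isMeromorphicExtension hg hext] at hgz
  · exact fun h => ⟨_, hext, h⟩

theorem meromorphicOrderAt_dim [Nonempty F.Edge] (hF : F.IsHomogeneous lam) (hd₀ : 0 < d)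
    (hd : (k : ℝ) * lam ^ d = 1) :
    meromorphicOrderAt (fun s : ℂ => F.edgeSum s / (1 - (k : ℂ) * (lam : ℂ) ^ s)) (d : ℂ) =
      ((-1 : ℤ) : WithTop ℤ) :=
  meromorphicOrderAt_div_eq_neg_one (analyticAt_edgeSum _)
    (hF.analyticAt_one_sub_card_mul_cpow _) (edgeSum_ofReal_ne_zero d)
    ((hF.one_sub_card_mul_cpow_eq_zero_iff hd₀ hd _).2 ⟨0, by simp⟩)
    (hF.deriv_one_sub_card_mul_cpow_ne_zero _)

end Poles

end SelfSimilarFractal.IsHomogeneous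

theorem theorem2p3_general {N k : ℕ} (F : SelfSimilarFractal N k) (lam : ℝ)
    (hV : F.V₀.Nontrivial) (hF : F.IsHomogeneous lam) (hU : F.OpenSetCondition)
    (d : ℝ) (hd : d = Real.log k / Real.log (1 / lam)) :
    metricDim F.dirac = d ∧
    IsMeromorphicExtension F.dirac (fun s : ℂ => F.edgeSum s / (1 - (k : ℂ) * (lam : ℂ) ^ s)) ∧
    dimensionSpectrum F.dirac =
      {z : ℂ | (∃ n : ℤ, z = (d : ℂ) * (1 + 2 * Real.pi * Complex.I / (Real.log k : ℂ) * n)) ∧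
        F.edgeSum z ≠ 0} ∧
    meromorphicOrderAt (fun s : ℂ => F.edgeSum s / (1 - (k : ℂ) * (lam : ℂ) ^ s)) (d : ℂ)
      = ((-1 : ℤ) : WithTop ℤ) ∧
    InMacaevIdeal (absNegPow F.dirac (d : ℂ)) ∧
    0 < MeasureTheory.Measure.hausdorffMeasure d F.K ∧
    MeasureTheory.Measure.hausdorffMeasure d F.K < ⊤ ∧
    ∀ ω : GeneralizedLimit,
      (∀ f : C(F.K, ℂ), ncIntegral F.dirac ω (F.rep f) =
        ((1 / Real.log k * ∑ e : F.Edge, e.len ^ d : ℝ) : ℂ) *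
          ∫ x, f x ∂(F.normalizedHausdorff d)) ∧
      ∀ ν : MeasureTheory.Measure F.K, MeasureTheory.IsFiniteMeasure ν →
        (∀ f : C(F.K, ℂ), ncIntegral F.dirac ω (F.rep f) = ∫ x, f x ∂ν) →
        ν = ENNReal.ofReal (1 / Real.log k * ∑ e : F.Edge, e.len ^ d) •
          F.normalizedHausdorff d := by
  have : Nonempty F.Edge := F.nonempty_edge_of_nontrivial_V₀ hV
  have hd₀ : 0 < d := hF.dim_pos (F.one_lt_card_of_nontrivial_V₀ hV) hd
  have hmoran : (k : ℝ) * lam ^ d = 1 := hF.card_mul_rpow_dim hd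
  exact ⟨hF.metricDim_dirac hd₀ hmoran,
    hF.isMeromorphicExtension_zetaFun_dirac hd₀ hmoran,
    hF.dimensionSpectrum_dirac hd₀ hmoran,
    hF.meromorphicOrderAt_dim hd₀ hmoran,
    hF.inMacaevIdeal_absNegPow_dirac hU hd₀ hmoran,
    hF.hausdorffMeasure_K_pos hU hd₀ hmoran,
    hF.hausdorffMeasure_K_lt_top hd₀ hmoran,
    fun ω => ⟨hF.ncIntegral_rep hU hd₀ hmoran ω,
      fun ν _ hν => hF.eq_smul_normalizedHausdorff hU hd₀ hmoran ω ν hν⟩⟩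

theorem theorem2p3 {N k : ℕ} (F : SelfSimilarFractal N k) (lam : ℝ) (hF : F.IsNested lam)
    (d : ℝ) (hd : d = Real.log k / Real.log (1 / lam)) :
    -- the metric dimension, and the meromorphic extension of the zeta function
    metricDim F.dirac = d ∧
    IsMeromorphicExtension F.dirac (fun s : ℂ => F.edgeSum s / (1 - (k : ℂ) * (lam : ℂ) ^ s)) ∧
    -- the dimension spectrum (points where the numerator vanishes are not poles)
    dimensionSpectrum F.dirac =
      {z : ℂ | (∃ n : ℤ, z = (d : ℂ) * (1 + 2 * Real.pi * Complex.I / (Real.log k : ℂ) * n)) ∧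
        F.edgeSum z ≠ 0} ∧
    -- the pole at `d` is simple
    meromorphicOrderAt (fun s : ℂ => F.edgeSum s / (1 - (k : ℂ) * (lam : ℂ) ^ s)) (d : ℂ)
      = ((-1 : ℤ) : WithTop ℤ) ∧
    -- summability, and the noncommutative integral
    InMacaevIdeal (absNegPow F.dirac (d : ℂ)) ∧
    0 < MeasureTheory.Measure.hausdorffMeasure d F.K ∧
    MeasureTheory.Measure.hausdorffMeasure d F.K < ⊤ ∧
    ∀ ω : GeneralizedLimit,
      (∀ f : C(F.K, ℂ), ncIntegral F.dirac ω (F.rep f) =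
        ((1 / Real.log k * ∑ e : F.Edge, e.len ^ d : ℝ) : ℂ) *
          ∫ x, f x ∂(F.normalizedHausdorff d)) ∧
      -- the measure that represents the functional `f ↦ ∮ f` is this multiple of `H_d`
      ∀ ν : MeasureTheory.Measure F.K, MeasureTheory.IsFiniteMeasure ν →
        (∀ f : C(F.K, ℂ), ncIntegral F.dirac ω (F.rep f) = ∫ x, f x ∂ν) →
        ν = ENNReal.ofReal (1 / Real.log k * ∑ e : F.Edge, e.len ^ d) •
          F.normalizedHausdorff d :=
  theorem2p3_general F lam hF.nontrivial_V₀ hF.ratio_eq hF.open_set_condition d hd
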